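/- Let $I=[0,1]$ with Lebesgue measure. A graphon is a symmetric measurable function $W\colon I\times I\to[0,\infty)$, and $d_\square(W_1,W_2)=\sup_{S,T}\left|\int_{S\times T}(W_1-W_2)\,du\,dv\right|$, the supremum being over Borel sets $S,T\subseteq I$ (with $d_\square(W_1,W_2)=\infty$ if $W_1-W_2$ is not integrable). Let $X^W$ be the multitype branching process started from one particle whose type is uniform on $I$, in which, independently for different particles, the children of a particle of type $x$ have types forming a Poisson random measure on $I$ with intensity $W(x,y)\,dy$. Fix an integer $k\ge 2$. For $d\ge1$ let $\mathcal{A}_d$ be the event that the root has at least $k$ children, each of these $k$ children has at least $k-1$ children, each of those has at least $k-1$ children, and so on until the $d$-th generation; let $\mathcal{A}=\bigcap_{d\ge1}\mathcal{A}_d$, and write $\mathbb{P}_{X^W}(\mathcal{A})$ for the probability that $X^W$ satisfies $\mathcal{A}$. **Proposition.** Let $(W_n)_{n\ge1}$ be a sequence of graphons that is uniformly bounded, i.e. $\sup_{n,x,y}W_n(x,y)\le\bar a$ for some constant $\bar a<\infty$, and let $W$ be a graphon such that $d_\square(W_n,W)\to0$. Suppose that the function $\lambda\mapsto\mathbb{P}_{X^{\lambda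 W}}(\mathcal{A})$, $\lambda\ge0$, is continuous from below at $\lambda=1$. Then $$\mathbb{P}_{X^{W_n}}(\mathcal{A})\longrightarrow\mathbb{P}_{X^{W}}(\mathcal{A})\qquad\text{as } n\to\infty.$$ -/

import Mathlib

open MeasureTheory ProbabilityTheory Filter Topology
open scoped NNReal ENNReal unitInterval

/-- A graphon (kernel): a symmetric measurable function `I × I → [0, ∞)`, where `I = [0,1]`. -/
structure Graphon where
  toFun : I × I → ℝ≥0
  measurable' : Measurable toFun
  symm' : ∀ x y : I, toFun (x, y) = toFun (y, x)

namespace Graphon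

instance : CoeFun Graphon (fun _ => I × I → ℝ≥0) := ⟨Graphon.toFun⟩

/-- The graphon `c W`, for a real number `c ≥ 0`. -/
instance : SMul ℝ≥0 Graphon where
  smul c W :=
    { toFun := fun p => c * W p
      measurable' := W.measurable'.const_mul c
      symm' := fun x y => by rw [W.symm' x y] }

end Graphon

open Classical in
/-- The cut norm `sup_{S,T} |∫_{S×T} U|` of a signed kernel `U`, the supremum being over the Borel
subsets `S, T` of `I`. It is `∞` for a kernel that is not integrable, where the integrals over
rectangles need not make sense. -/
noncomputable def cutNorm (U : I × I → ℝ) : ℝ≥0∞ :=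
  if Integrable U then
    ⨆ (S : Set I) (T : Set I) (_ : MeasurableSet S) (_ : MeasurableSet T),
      ‖∫ p in S ×ˢ T, U p‖ₑ
  else ⊤

/-- The cut metric `d_□(W₁, W₂) = ‖W₁ - W₂‖_□` (without relabelling of the unit interval). -/
noncomputable def cutDist (W₁ W₂ : Graphon) : ℝ≥0∞ :=
  cutNorm (fun p => (W₁ p : ℝ) - (W₂ p : ℝ))

/-! ### The branching process of a graphon

A Poisson random measure on `I` with finite intensity `W(x, y) dy` is realised as a
Poisson(`∫ W(x, y) dy`) number of independent points, each with law `W(x, y) dy / ∫ W(x, y) dy`.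
Particles are labelled by words in the Ulam-Harris way: `[]` is the root, and `i :: v` is the
child number `i` (counted from `0`) of `v`. Each word `v` carries two independent uniform random
variables, the first one for the type of `v` and the second one for the number of children of `v`.
Types and numbers are attached to all words; the particles that are really born are the words
obtained from the root by going successively to children number `i < (number of children)`. -/

/-- The expected number of children, with types in `A`, of a particle of type `x`:
`∫_A W(x, y) dy`. -/
noncomputable def Graphon.intensity (W : Graphon) (x : I) (A : Set I) : ℝ≥0∞ :=
  ∫⁻ y in A, (W (x, y) : ℝ≥0∞)

/-- Inverse transform sampling of the type of a child of a particle of type `x`: the quantile at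
level `u` of the probability measure `W(x, y) dy / ∫ W(x, y) dy` on `I`. -/
noncomputable def Graphon.childType (W : Graphon) (x u : I) : I :=
  sInf {t : I | ENNReal.ofReal u * W.intensity x Set.univ ≤ W.intensity x (Set.Iic t)}

/-- Inverse transform sampling of the Poisson distribution with mean `r`. -/
noncomputable def poissonQuantile (r : ℝ≥0) (u : I) : ℕ :=
  sInf {m : ℕ | ENNReal.ofReal u ≤ poissonMeasure r (Set.Iic m)}

/-- The randomness: a pair of points of `I` for each word. -/
abbrev Noise : Type := List ℕ → I × I

/-- All the points are independent and uniformly distributed. -/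
noncomputable def noiseMeasure : Measure Noise :=
  Measure.infinitePi (fun _ : List ℕ => (volume : Measure (I × I)))

/-- The type of the particle `v`; the type of the root is uniform on `I`. -/
noncomputable def Graphon.particleType (W : Graphon) (ω : Noise) : List ℕ → I
  | [] => (ω []).1
  | i :: v => W.childType (W.particleType ω v) (ω (i :: v)).1

/-- The number of children of the particle `v`: conditionally on the type `x` of `v`, it is Poisson
with mean `∫ W(x, y) dy`. (For an integrable `W` this mean is finite for almost every `x`, and a type
with an infinite mean almost surely never occurs.) -/
noncomputable def Graphon.numChildren (W : Graphon) (ω : Noise) (v : List ℕ) : ℕ :=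
  poissonQuantile (W.intensity (W.particleType ω v) Set.univ).toNNReal (ω v).2

/-- In the family tree with offspring numbers `N`, the particle `v` has at least `k - 1` children,
each of these has at least `k - 1` children, and so on for `d` generations. -/
def PropertyB (k : ℕ) (N : List ℕ → ℕ) : ℕ → List ℕ → Prop
  | 0, _ => True
  | d + 1, v => ∃ S : Finset ℕ, S.card = k - 1 ∧ ∀ i ∈ S, i < N v ∧ PropertyB k N d (i :: v)

/-- The property `𝒜_d`: the root has at least `k` children, each of these `k` children has at least
`k - 1` children, each of those has at least `k - 1` children, and so on until generation `d`. -/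
def PropertyA (k : ℕ) (N : List ℕ → ℕ) : ℕ → Prop
  | 0 => True
  | d + 1 => ∃ S : Finset ℕ, S.card = k ∧ ∀ i ∈ S, i < N [] ∧ PropertyB k N d [i]

/-- `P_{X^W}(𝒜)`: the probability that the branching process of `W` lies in `𝒜 = ⋂_d 𝒜_d`. -/
noncomputable def Graphon.probA (k : ℕ) (W : Graphon) : ℝ :=
  noiseMeasure.real (⋂ d : ℕ, {ω : Noise | PropertyA k (W.numChildren ω) d})

/-! Put `j = k - 1` and let `T_V` be the integral operator `kernelOp V`. By Poisson thinning, the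
children of a type `x` particle that have a property of probability `f(y)` at type `y` are Poisson
in number with mean `T_V f(x)`. Hence the probabilities of `𝓑_d` are the iterates `survProb` of `f ↦
poissonTail j (T_V f)` started at `1`. They decrease to `survLim`, which dominates every subsolution
`g ≤ poissonTail j (T_V g)` (`le_survLim`), and the probability of `𝒜` is `rootProb`
(`probA_eq_rootProb`).

Upper bound (`eventually_rootProb_le`): if `V`, `V'` are `δ`-close in the cut norm, then `T_V f` and
`T_V' f` are `2δ`-close in `L¹`, uniformly over `f` with values in `[0,1]`. So each finite-depth
probability converges, and the probability of `𝒜` is the limit of these as they decrease in the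
depth.

Lower bound (`eventually_le_rootProb`): let `f` be the maximal fixed point for `s² W` with `s < 1`.
One factor `s` pays for discarding the values of `f` below a small `c`; the other pays for replacing
`W` by `W_n`. Cut closeness gives no pointwise comparison, so the points where the inequality fails
are removed. Removal lowers the operator and may create new bad points, but each bad point carries a
definite deficit between the two kernels, and the cut norm bounds the integrated deficit; the total
removed stays small (`exists_removable_set`). What remains of `f` is a subsolution for `W_n`. Thus
the liminf is at least the probability for `s² W`, and continuity from below lets `s → 1`.

The limit `W` is bounded by `a` only almost everywhere (`ae_le_of_tendsto_rectangles`), so it is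
replaced by `min W a`. -/

/-! ### Poisson tails as functions of the mean -/

/-- The probability that a Poisson variable with mean `t` is at least `j`. -/
noncomputable def poissonTail (j : ℕ) (t : ℝ) : ℝ :=
  1 - ∑ l ∈ Finset.range j, Real.exp (-t) * t ^ l / (l.factorial : ℝ)

theorem poissonTail_succ (j : ℕ) (t : ℝ) :
    poissonTail (j + 1) t = poissonTail j t - Real.exp (-t) * t ^ j / (j.factorial : ℝ) := by
  simp only [poissonTail, Finset.sum_range_succ]
  ring

theorem poissonTail_zero_right (j : ℕ) : poissonTail (j + 1) 0 = 0 := by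
  simp [poissonTail, Finset.sum_range_succ']

/-- The derivatives of the subtracted Poisson masses telescope, leaving only the last mass. -/
theorem hasDerivAt_poissonTail (j : ℕ) (t : ℝ) :
    HasDerivAt (poissonTail (j + 1)) (Real.exp (-t) * t ^ j / (j.factorial : ℝ)) t := by
  induction j with
  | zero =>
    have h : poissonTail 1 = fun t => 1 - Real.exp (-t) := by
      ext t; simp [poissonTail]
    rw [zero_add, h]
    convert! ((hasDerivAt_neg t).exp.const_sub 1) using 1
    simp
  | succ j ih =>
    have h : poissonTail (j + 1 + 1) = fun t => poissonTail (j + 1) t -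
        Real.exp (-t) * t ^ (j + 1) / ((j + 1).factorial : ℝ) :=
      funext fun t => poissonTail_succ (j + 1) t
    rw [h]
    convert! ih.sub (((hasDerivAt_neg t).exp.mul (hasDerivAt_pow (j + 1) t)).div_const
      ((j + 1).factorial : ℝ)) using 1
    have h1 : (j.factorial : ℝ) ≠ 0 := by positivity
    have h2 : ((j : ℝ) + 1) ≠ 0 := by positivity
    simp only [Nat.factorial_succ, Nat.cast_mul, Nat.cast_add, Nat.cast_one, add_tsub_cancel_right]
    field_simp
    ring

theorem continuous_poissonTail (j : ℕ) : Continuous (poissonTail j) := by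
  unfold poissonTail; fun_prop

theorem measurable_poissonTail (j : ℕ) : Measurable (poissonTail j) :=
  (continuous_poissonTail j).measurable

theorem monotoneOn_poissonTail (j : ℕ) : MonotoneOn (poissonTail j) (Set.Ici 0) := by
  cases j with
  | zero => intro x _ y _ _; simp [poissonTail]
  | succ j =>
    refine monotoneOn_of_deriv_nonneg (convex_Ici 0) (continuous_poissonTail _).continuousOn
      (fun t _ => (hasDerivAt_poissonTail j t).differentiableAt.differentiableWithinAt) ?_
    intro t ht
    rw [interior_Ici] at ht
    have : (0 : ℝ) < t := ht
    rw [(hasDerivAt_poissonTail j t).deriv]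
    positivity

theorem poissonTail_mono (j : ℕ) {s t : ℝ} (hs : 0 ≤ s) (hst : s ≤ t) :
    poissonTail j s ≤ poissonTail j t :=
  monotoneOn_poissonTail j hs (hs.trans hst : (0 : ℝ) ≤ t) hst

theorem poissonTail_nonneg (j : ℕ) {t : ℝ} (ht : 0 ≤ t) : 0 ≤ poissonTail j t := by
  refine le_trans ?_ (poissonTail_mono j le_rfl ht)
  cases j with
  | zero => simp [poissonTail]
  | succ j => exact (poissonTail_zero_right j).ge

theorem poissonTail_le_one (j : ℕ) {t : ℝ} (ht : 0 ≤ t) : poissonTail j t ≤ 1 := by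
  rw [poissonTail, sub_le_self_iff]
  exact Finset.sum_nonneg fun l _ => by positivity

/-- The derivative is a Poisson mass, hence at most `1`. This turns `L¹` bounds on means into `L¹`
bounds on probabilities. -/
theorem abs_poissonTail_sub_le (j : ℕ) {s t : ℝ} (hs : 0 ≤ s) (ht : 0 ≤ t) :
    |poissonTail j s - poissonTail j t| ≤ |s - t| := by
  cases j with
  | zero => simp [poissonTail]
  | succ j =>
    have := (convex_Ici (0 : ℝ)).norm_image_sub_le_of_norm_hasDerivWithin_le (C := 1)
      (f := poissonTail (j + 1)) (fun x _ => (hasDerivAt_poissonTail j x).hasDerivWithinAt)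
      (fun x hx => ?_) ht hs
    · simpa using this
    · have hx : (0 : ℝ) ≤ x := hx
      rw [Real.norm_of_nonneg (by positivity), mul_div_assoc, Real.exp_neg,
        inv_mul_le_one₀ (Real.exp_pos x)]
      exact Real.pow_div_factorial_le_exp x hx j

/-- For `j ≥ 1` the tail starts at `0` and is 1-Lipschitz. This is where `k ≥ 2` enters: where a
fixed point is at least `c`, so is its mean. -/
theorem poissonTail_le_self {j : ℕ} (hj : 1 ≤ j) {t : ℝ} (ht : 0 ≤ t) : poissonTail j t ≤ t := by
  obtain ⟨j, rfl⟩ := Nat.exists_eq_add_of_le' hj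
  have := abs_poissonTail_sub_le (j + 1) ht le_rfl
  rw [poissonTail_zero_right, sub_zero, sub_zero, abs_of_nonneg ht] at this
  exact (le_abs_self _).trans this

/-! ### Bounded kernels and their integral operators -/

/-- A measurable function with values in `[0, 1]`. -/
structure IsUnitFun (f : I → ℝ) : Prop where
  measurable : Measurable f
  nonneg : ∀ x, 0 ≤ f x
  le_one : ∀ x, f x ≤ 1

/-- A measurable kernel with values in `[0, a]`. -/
structure IsBddKernel (a : ℝ) (V : I × I → ℝ) : Prop where
  measurable : Measurable V
  nonneg : ∀ p, 0 ≤ V p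
  le : ∀ p, V p ≤ a

/-- The integral operator with kernel `V`. -/
noncomputable def kernelOp (V : I × I → ℝ) (f : I → ℝ) (x : I) : ℝ := ∫ y, V (x, y) * f y

theorem integrable_of_abs_le {α : Type*} [MeasurableSpace α] {μ : Measure α} [IsFiniteMeasure μ]
    {f : α → ℝ} (hf : Measurable f) {C : ℝ} (h : ∀ x, |f x| ≤ C) : Integrable f μ :=
  Integrable.of_bound hf.aestronglyMeasurable C (Eventually.of_forall h)

theorem IsUnitFun.abs_le_one {f : I → ℝ} (hf : IsUnitFun f) (x : I) : |f x| ≤ 1 := by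
  rw [abs_of_nonneg (hf.nonneg x)]; exact hf.le_one x

theorem IsUnitFun.integrable {f : I → ℝ} (hf : IsUnitFun f) : Integrable f :=
  integrable_of_abs_le hf.measurable hf.abs_le_one

theorem IsUnitFun.indicator {f : I → ℝ} (hf : IsUnitFun f) {s : Set I} (hs : MeasurableSet s) :
    IsUnitFun (s.indicator f) where
  measurable := hf.measurable.indicator hs
  nonneg := Set.indicator_nonneg fun x _ => hf.nonneg x
  le_one x := (Set.indicator_le_self' (fun _ _ => hf.nonneg _) x).trans (hf.le_one x)

namespace IsBddKernel

variable {a : ℝ} {V : I × I → ℝ}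

theorem bound_nonneg (hV : IsBddKernel a V) : 0 ≤ a := (hV.nonneg (0, 0)).trans (hV.le _)

theorem abs_le (hV : IsBddKernel a V) (p : I × I) : |V p| ≤ a := by
  rw [abs_of_nonneg (hV.nonneg p)]; exact hV.le p

theorem integrable_mul (hV : IsBddKernel a V) {f : I → ℝ} (hf : IsUnitFun f) (x : I) :
    Integrable fun y => V (x, y) * f y := by
  refine integrable_of_abs_le ((hV.measurable.comp measurable_prodMk_left).mul hf.measurable)
    (C := a) fun y => ?_
  rw [abs_mul]
  exact (mul_le_mul (hV.abs_le _) (hf.abs_le_one y) (abs_nonneg _) hV.bound_nonneg).trans_eq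
    (mul_one a)

theorem measurable_kernelOp (hV : IsBddKernel a V) {f : I → ℝ} (hf : IsUnitFun f) :
    Measurable (kernelOp V f) := by
  have : StronglyMeasurable fun p : I × I => V p * f p.2 :=
    (hV.measurable.mul (hf.measurable.comp measurable_snd)).stronglyMeasurable
  exact this.integral_prod_right.measurable

theorem kernelOp_nonneg (hV : IsBddKernel a V) {f : I → ℝ} (hf : IsUnitFun f) (x : I) :
    0 ≤ kernelOp V f x :=
  integral_nonneg fun y => mul_nonneg (hV.nonneg _) (hf.nonneg y)

theorem kernelOp_mono (hV : IsBddKernel a V) {f g : I → ℝ} (hf : IsUnitFun f) (hg : IsUnitFun g)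
    (h : ∀ y, f y ≤ g y) (x : I) : kernelOp V f x ≤ kernelOp V g x :=
  integral_mono (hV.integrable_mul hf x) (hV.integrable_mul hg x) fun y =>
    mul_le_mul_of_nonneg_left (h y) (hV.nonneg _)

theorem abs_kernelOp_sub_le (hV : IsBddKernel a V) {f g : I → ℝ} (hf : IsUnitFun f)
    (hg : IsUnitFun g) (x : I) :
    |kernelOp V f x - kernelOp V g x| ≤ a * ∫ y, |f y - g y| := by
  rw [kernelOp, kernelOp, ← integral_sub (hV.integrable_mul hf x) (hV.integrable_mul hg x),
    ← integral_const_mul]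
  refine (abs_integral_le_integral_abs).trans (integral_mono ?_ ?_ fun y => ?_)
  · exact ((hV.integrable_mul hf x).sub (hV.integrable_mul hg x)).abs
  · exact ((hf.integrable.sub hg.integrable).abs).const_mul a
  · simp only []
    rw [← mul_sub, abs_mul]
    exact mul_le_mul_of_nonneg_right (hV.abs_le _) (abs_nonneg _)

theorem kernelOp_le (hV : IsBddKernel a V) {f : I → ℝ} (hf : IsUnitFun f) (x : I) :
    kernelOp V f x ≤ a := by
  have h0 : IsUnitFun fun _ => (0 : ℝ) := ⟨measurable_const, fun _ => le_rfl, fun _ => zero_le_one⟩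
  have := hV.abs_kernelOp_sub_le hf h0 x
  have h1 : kernelOp V (fun _ => (0 : ℝ)) x = 0 := by simp [kernelOp]
  rw [h1, sub_zero] at this
  refine (le_abs_self _).trans (this.trans ?_)
  have h2 : ∫ y, |f y - 0| ≤ 1 := by
    calc ∫ y, |f y - 0| ≤ ∫ _ : I, (1 : ℝ) :=
          integral_mono (by simpa using hf.integrable.abs) (integrable_const _)
            fun y => by simpa using hf.abs_le_one y
      _ = 1 := by simp
  nlinarith [hV.bound_nonneg]

theorem abs_kernelOp_le (hV : IsBddKernel a V) {f : I → ℝ} (hf : IsUnitFun f) (x : I) :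
    |kernelOp V f x| ≤ a := by
  rw [abs_of_nonneg (hV.kernelOp_nonneg hf x)]; exact hV.kernelOp_le hf x

theorem integrable_kernelOp (hV : IsBddKernel a V) {f : I → ℝ} (hf : IsUnitFun f)
    (μ : Measure I) [IsFiniteMeasure μ] : Integrable (kernelOp V f) μ :=
  integrable_of_abs_le (hV.measurable_kernelOp hf) (hV.abs_kernelOp_le hf)

/-- Decreasing `f` by at most `c` on a set `s` decreases `kernelOp V f` by at most `a c |s|`. -/
theorem kernelOp_sub_indicator_le (hV : IsBddKernel a V) {f g : I → ℝ} (hf : IsUnitFun f)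
    (hg : IsUnitFun g) {s : Set I} (hs : MeasurableSet s) {c : ℝ}
    (h : ∀ y, f y - g y ≤ s.indicator (fun _ => c) y) (hgf : ∀ y, g y ≤ f y) (x : I) :
    kernelOp V f x - kernelOp V g x ≤ a * (c * volume.real s) := by
  refine (le_abs_self _).trans ((hV.abs_kernelOp_sub_le hf hg x).trans ?_)
  refine mul_le_mul_of_nonneg_left ?_ hV.bound_nonneg
  calc ∫ y, |f y - g y| ≤ ∫ y, s.indicator (fun _ => c) y := by
        refine integral_mono (hf.integrable.sub hg.integrable).abs
          ((integrable_const c).indicator hs) fun y => ?_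
        simp only []
        rw [abs_of_nonneg (sub_nonneg.2 (hgf y))]
        exact h y
    _ = c * volume.real s := by
        rw [integral_indicator hs, setIntegral_const, smul_eq_mul, mul_comm]

theorem tendsto_kernelOp (hV : IsBddKernel a V) {f : ℕ → I → ℝ} {g : I → ℝ}
    (hf : ∀ n, IsUnitFun (f n)) (h : ∀ y, Tendsto (fun n => f n y) atTop (𝓝 (g y))) (x : I) :
    Tendsto (fun n => kernelOp V (f n) x) atTop (𝓝 (kernelOp V g x)) := by
  refine tendsto_integral_of_dominated_convergence (fun _ => a)
    (fun n => (hV.integrable_mul (hf n) x).aestronglyMeasurable) (integrable_const a)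
    (fun n => Eventually.of_forall fun y => ?_)
    (Eventually.of_forall fun y => (h y).const_mul _)
  rw [Real.norm_eq_abs, abs_mul]
  exact (mul_le_mul (hV.abs_le _) ((hf n).abs_le_one y) (abs_nonneg _) hV.bound_nonneg).trans_eq
    (mul_one a)

theorem isUnitFun_poissonTail (hV : IsBddKernel a V) (j : ℕ) {f : I → ℝ} (hf : IsUnitFun f) :
    IsUnitFun fun x => poissonTail j (kernelOp V f x) where
  measurable := (measurable_poissonTail j).comp (hV.measurable_kernelOp hf)
  nonneg x := poissonTail_nonneg j (hV.kernelOp_nonneg hf x)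
  le_one x := poissonTail_le_one j (hV.kernelOp_nonneg hf x)

theorem smul (hV : IsBddKernel a V) {c : ℝ} (hc0 : 0 ≤ c) (hc1 : c ≤ 1) :
    IsBddKernel a fun p => c * V p where
  measurable := hV.measurable.const_mul c
  nonneg p := mul_nonneg hc0 (hV.nonneg p)
  le p := (mul_le_of_le_one_left (hV.nonneg p) hc1).trans (hV.le p)

end IsBddKernel

theorem kernelOp_const_mul (V : I × I → ℝ) (c : ℝ) (f : I → ℝ) (x : I) :
    kernelOp (fun p => c * V p) f x = c * kernelOp V f x := by
  simp only [kernelOp, mul_assoc, integral_const_mul]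

/-! ### Cut closeness controls the integral operator in `L¹` -/

/-- All integrals of `V - V'` over rectangles are at most `δ` in absolute value. -/
def CutLe (δ : ℝ) (V V' : I × I → ℝ) : Prop :=
  ∀ S T : Set I, MeasurableSet S → MeasurableSet T → |∫ p in S ×ˢ T, (V p - V' p)| ≤ δ

theorem CutLe.symm {δ : ℝ} {V V' : I × I → ℝ} (h : CutLe δ V V') : CutLe δ V' V := by
  intro S T hS hT
  have : (∫ p in S ×ˢ T, (V' p - V p)) = -∫ p in S ×ˢ T, (V p - V' p) := by
    rw [← integral_neg]; simp
  rw [this, abs_neg]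
  exact h S T hS hT

theorem CutLe.nonneg {δ : ℝ} {V V' : I × I → ℝ} (h : CutLe δ V V') : 0 ≤ δ :=
  (abs_nonneg _).trans (h ∅ ∅ MeasurableSet.empty MeasurableSet.empty)

/-- By Fubini the left side is `∫ H f` with `H(y) = ∫_S (V - V')(x, y) dx`. Over `f` with values in
`[0,1]` this linear functional is largest at the indicator of `{H > 0}`, where it is the integral
over a rectangle. -/
theorem CutLe.setIntegral_kernelOp_sub_le {δ a : ℝ} {V V' : I × I → ℝ} (h : CutLe δ V V')
    (hV : IsBddKernel a V) (hV' : IsBddKernel a V') {f : I → ℝ} (hf : IsUnitFun f) {S : Set I}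
    (hS : MeasurableSet S) : ∫ x in S, (kernelOp V f x - kernelOp V' f x) ≤ δ := by
  set U : I × I → ℝ := fun p => V p - V' p with hU
  have hUm : Measurable U := hV.measurable.sub hV'.measurable
  have hUb : ∀ p, |U p| ≤ a := fun p => by
    rw [abs_le]; constructor <;> linarith [hV.nonneg p, hV'.nonneg p, hV.le p, hV'.le p]
  set H : I → ℝ := fun y => ∫ x in S, U (x, y) with hH
  have hHm : Measurable H := by
    have : StronglyMeasurable fun p : I × I => U (p.2, p.1) :=
      (hUm.comp measurable_swap).stronglyMeasurable
    exact (this.integral_prod_right (ν := volume.restrict S)).measurable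
  have hUi : Integrable U ((volume.restrict S).prod volume) := integrable_of_abs_le hUm hUb
  have hUfi : Integrable (fun p : I × I => U p * f p.2) ((volume.restrict S).prod volume) := by
    refine integrable_of_abs_le (C := a) (hUm.mul (hf.measurable.comp measurable_snd)) fun p => ?_
    rw [abs_mul]
    exact (mul_le_mul (hUb _) (hf.abs_le_one _) (abs_nonneg _) hV.bound_nonneg).trans_eq
      (mul_one a)
  have hHi : Integrable H := hUi.integral_prod_right
  have hT : MeasurableSet {y | 0 < H y} := measurableSet_lt measurable_const hHm
  calc ∫ x in S, (kernelOp V f x - kernelOp V' f x)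
      = ∫ x in S, ∫ y, U (x, y) * f y := by
        refine integral_congr_ae (Eventually.of_forall fun x => ?_)
        simp only [kernelOp, hU]
        rw [← integral_sub (hV.integrable_mul hf x) (hV'.integrable_mul hf x)]
        simp only [sub_mul]
    _ = ∫ y, ∫ x in S, U (x, y) * f y := integral_integral_swap hUfi
    _ = ∫ y, H y * f y := by simp only [integral_mul_const, hH]
    _ ≤ ∫ y, {y | 0 < H y}.indicator H y := by
        refine integral_mono ?_ (hHi.indicator hT) fun y => ?_
        · simpa only [integral_mul_const] using hUfi.integral_prod_right
        · by_cases hy : 0 < H y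
          · rw [Set.indicator_of_mem (by exact hy)]
            exact mul_le_of_le_one_right hy.le (hf.le_one y)
          · rw [Set.indicator_of_notMem (by exact hy)]
            exact mul_nonpos_of_nonpos_of_nonneg (not_lt.1 hy) (hf.nonneg y)
    _ = ∫ y in {y | 0 < H y}, H y := integral_indicator hT
    _ = ∫ p in S ×ˢ {y | 0 < H y}, U p := by
        rw [Measure.volume_eq_prod, ← Measure.prod_restrict, integral_prod_symm]
        exact integrable_of_abs_le hUm hUb
    _ ≤ δ := (le_abs_self _).trans (h S _ hS hT)

/-- Split according to the sign of the difference; each half contributes at most `δ`. -/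
theorem CutLe.integral_abs_kernelOp_sub_le {δ a : ℝ} {V V' : I × I → ℝ} (h : CutLe δ V V')
    (hV : IsBddKernel a V) (hV' : IsBddKernel a V') {f : I → ℝ} (hf : IsUnitFun f) :
    ∫ x, |kernelOp V f x - kernelOp V' f x| ≤ 2 * δ := by
  set G : I → ℝ := fun x => kernelOp V f x - kernelOp V' f x with hG
  have hGm : Measurable G := (hV.measurable_kernelOp hf).sub (hV'.measurable_kernelOp hf)
  have hGi : Integrable G := (hV.integrable_kernelOp hf _).sub (hV'.integrable_kernelOp hf _)
  have hS : MeasurableSet {x | 0 ≤ G x} := measurableSet_le measurable_const hGm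
  have h1 := h.setIntegral_kernelOp_sub_le hV hV' hf hS
  have h2 := h.symm.setIntegral_kernelOp_sub_le hV' hV hf hS.compl
  rw [← integral_add_compl hS hGi.abs]
  have e1 : ∫ x in {x | 0 ≤ G x}, |G x| = ∫ x in {x | 0 ≤ G x}, G x :=
    setIntegral_congr_fun hS fun x hx => abs_of_nonneg hx
  have e2 : ∫ x in {x | 0 ≤ G x}ᶜ, |G x|
      = ∫ x in {x | 0 ≤ G x}ᶜ, (kernelOp V' f x - kernelOp V f x) := by
    refine setIntegral_congr_fun hS.compl fun x hx => ?_
    have : G x < 0 := not_le.1 hx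
    exact (abs_of_neg this).trans (neg_sub _ _)
  rw [e1, e2]
  linarith

/-! ### Survival probabilities as a maximal fixed point -/

/-- The probability that a particle of type `x` has property `𝓑_d`, computed recursively. -/
noncomputable def survProb (j : ℕ) (V : I × I → ℝ) : ℕ → I → ℝ
  | 0 => fun _ => 1
  | d + 1 => fun x => poissonTail j (kernelOp V (survProb j V d) x)

/-- The limit of `survProb j V d` as `d → ∞`. -/
noncomputable def survLim (j : ℕ) (V : I × I → ℝ) (x : I) : ℝ := ⨅ d, survProb j V d x

/-- The integral over the root type of the probability of at least `j + 1`
surviving children. -/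
noncomputable def rootProb (j : ℕ) (V : I × I → ℝ) : ℝ :=
  ∫ x, poissonTail (j + 1) (kernelOp V (survLim j V) x)

namespace IsBddKernel

variable {a : ℝ} {V : I × I → ℝ}

theorem isUnitFun_survProb (hV : IsBddKernel a V) (j d : ℕ) : IsUnitFun (survProb j V d) := by
  induction d with
  | zero => exact ⟨measurable_const, fun _ => zero_le_one, fun _ => le_rfl⟩
  | succ d ih => exact hV.isUnitFun_poissonTail j ih

theorem antitone_survProb (hV : IsBddKernel a V) (j : ℕ) (x : I) :
    Antitone fun d => survProb j V d x := by
  refine antitone_nat_of_succ_le fun d => ?_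
  induction d generalizing x with
  | zero => exact (hV.isUnitFun_survProb j 1).le_one x
  | succ d ih =>
    exact poissonTail_mono j (hV.kernelOp_nonneg (hV.isUnitFun_survProb j _) x)
      (hV.kernelOp_mono (hV.isUnitFun_survProb j _) (hV.isUnitFun_survProb j _) ih x)

theorem tendsto_survProb (hV : IsBddKernel a V) (j : ℕ) (x : I) :
    Tendsto (fun d => survProb j V d x) atTop (𝓝 (survLim j V x)) :=
  tendsto_atTop_ciInf (hV.antitone_survProb j x)
    ⟨0, by rintro _ ⟨d, rfl⟩; exact (hV.isUnitFun_survProb j d).nonneg x⟩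

theorem isUnitFun_survLim (hV : IsBddKernel a V) (j : ℕ) : IsUnitFun (survLim j V) where
  measurable := measurable_of_tendsto_metrizable (fun d => (hV.isUnitFun_survProb j d).measurable)
    (tendsto_pi_nhds.2 fun x => hV.tendsto_survProb j x)
  nonneg x := ge_of_tendsto' (hV.tendsto_survProb j x) fun d => (hV.isUnitFun_survProb j d).nonneg x
  le_one x := le_of_tendsto' (hV.tendsto_survProb j x) fun d => (hV.isUnitFun_survProb j d).le_one x

theorem survLim_eq (hV : IsBddKernel a V) (j : ℕ) (x : I) :
    survLim j V x = poissonTail j (kernelOp V (survLim j V) x) :=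
  tendsto_nhds_unique ((tendsto_add_atTop_iff_nat 1).2 (hV.tendsto_survProb j x))
    (((continuous_poissonTail j).tendsto _).comp
      (hV.tendsto_kernelOp (hV.isUnitFun_survProb j) (hV.tendsto_survProb j) x))

/-- The iteration starts at `1 ≥ g` and is monotone, so a subsolution stays below every iterate. -/
theorem le_survLim (hV : IsBddKernel a V) (j : ℕ) {g : I → ℝ} (hg : IsUnitFun g)
    (h : ∀ x, g x ≤ poissonTail j (kernelOp V g x)) (x : I) : g x ≤ survLim j V x := by
  have key : ∀ d x, g x ≤ survProb j V d x := by
    intro d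
    induction d with
    | zero => exact hg.le_one
    | succ d ih =>
      intro x
      exact (h x).trans (poissonTail_mono j (hV.kernelOp_nonneg hg x)
        (hV.kernelOp_mono hg (hV.isUnitFun_survProb j d) ih x))
  exact ge_of_tendsto' (hV.tendsto_survProb j x) fun d => key d x

theorem tendsto_integral_survProb (hV : IsBddKernel a V) (j : ℕ) :
    Tendsto (fun d => ∫ x, poissonTail (j + 1) (kernelOp V (survProb j V d) x)) atTop
      (𝓝 (rootProb j V)) := by
  refine tendsto_integral_of_dominated_convergence (fun _ => 1)
    (fun d => (hV.isUnitFun_poissonTail _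
      (hV.isUnitFun_survProb j d)).measurable.aestronglyMeasurable)
    (integrable_const _)
    (fun d => Eventually.of_forall (hV.isUnitFun_poissonTail _
      (hV.isUnitFun_survProb j d)).abs_le_one)
    (Eventually.of_forall fun x => ((continuous_poissonTail _).tendsto _).comp
      (hV.tendsto_kernelOp (hV.isUnitFun_survProb j) (hV.tendsto_survProb j) x))

theorem rootProb_le (hV : IsBddKernel a V) (j d : ℕ) :
    rootProb j V ≤ ∫ x, poissonTail (j + 1) (kernelOp V (survProb j V d) x) := by
  refine integral_mono (hV.isUnitFun_poissonTail _ (hV.isUnitFun_survLim j)).integrable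
    (hV.isUnitFun_poissonTail _ (hV.isUnitFun_survProb j d)).integrable fun x => ?_
  refine poissonTail_mono _ (hV.kernelOp_nonneg (hV.isUnitFun_survLim j) x)
    (hV.kernelOp_mono (hV.isUnitFun_survLim j) (hV.isUnitFun_survProb j d) (fun y => ?_) x)
  exact (hV.antitone_survProb j y).le_of_tendsto (hV.tendsto_survProb j y) d

theorem integral_poissonTail_sub_le (hV : IsBddKernel a V) {V' : I × I → ℝ}
    (hV' : IsBddKernel a V') (j : ℕ) {f g : I → ℝ} (hf : IsUnitFun f) (hg : IsUnitFun g) :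
    ∫ x, |poissonTail j (kernelOp V f x) - poissonTail j (kernelOp V' g x)| ≤
      ∫ x, |kernelOp V f x - kernelOp V' g x| :=
  integral_mono ((hV.isUnitFun_poissonTail j hf).integrable.sub
      (hV'.isUnitFun_poissonTail j hg).integrable).abs
    ((hV.integrable_kernelOp hf _).sub (hV'.integrable_kernelOp hg _)).abs fun x =>
    abs_poissonTail_sub_le j (hV.kernelOp_nonneg hf x) (hV'.kernelOp_nonneg hg x)

end IsBddKernel

/-! ### Upper semicontinuity through finite depth -/

theorem CutLe.integral_abs_kernelOp_sub_le_add {δ a : ℝ} {V V' : I × I → ℝ} (h : CutLe δ V V')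
    (hV : IsBddKernel a V) (hV' : IsBddKernel a V') {f g : I → ℝ} (hf : IsUnitFun f)
    (hg : IsUnitFun g) :
    ∫ x, |kernelOp V f x - kernelOp V' g x| ≤ 2 * δ + a * ∫ x, |f x - g x| := by
  have h1 := h.integral_abs_kernelOp_sub_le hV hV' hg
  have i1 := ((hV.integrable_kernelOp hf volume).sub (hV'.integrable_kernelOp hg _)).abs
  have i2 := ((hV.integrable_kernelOp hg volume).sub (hV'.integrable_kernelOp hg _)).abs
  calc ∫ x, |kernelOp V f x - kernelOp V' g x|
      ≤ ∫ x, (|kernelOp V g x - kernelOp V' g x| + a * ∫ y, |f y - g y|) := by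
        refine integral_mono i1 (i2.add (integrable_const _)) fun x => ?_
        have h2 := hV.abs_kernelOp_sub_le hf hg x
        have h3 := abs_sub_le (kernelOp V f x) (kernelOp V g x) (kernelOp V' g x)
        simp only []
        linarith
    _ = (∫ x, |kernelOp V g x - kernelOp V' g x|) + a * ∫ y, |f y - g y| := by
        refine (integral_add i2 (integrable_const _)).trans ?_
        simp
    _ ≤ _ := by linarith

/-- Each generation multiplies the `L¹` error by at most `a` and adds `2δ`; for fixed depth this
tends to `0`. -/
theorem tendsto_integral_abs_survProb_sub {a : ℝ} {Vn : ℕ → I × I → ℝ} {V : I × I → ℝ} {δ : ℕ → ℝ}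
    (hVn : ∀ n, IsBddKernel a (Vn n)) (hV : IsBddKernel a V) (hcut : ∀ n, CutLe (δ n) (Vn n) V)
    (hδ : Tendsto δ atTop (𝓝 0)) (j d : ℕ) :
    Tendsto (fun n => ∫ x, |survProb j (Vn n) d x - survProb j V d x|) atTop (𝓝 0) := by
  induction d with
  | zero => simp [survProb]
  | succ d ih =>
    have hlim : Tendsto (fun n => 2 * δ n + a * ∫ x, |survProb j (Vn n) d x - survProb j V d x|)
        atTop (𝓝 0) := by simpa using (hδ.const_mul 2).add (ih.const_mul a)
    refine squeeze_zero (fun n => integral_nonneg fun x => abs_nonneg _) (fun n => ?_) hlim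
    exact ((hVn n).integral_poissonTail_sub_le hV j ((hVn n).isUnitFun_survProb j d)
      (hV.isUnitFun_survProb j d)).trans ((hcut n).integral_abs_kernelOp_sub_le_add (hVn n) hV
      ((hVn n).isUnitFun_survProb j d) (hV.isUnitFun_survProb j d))

theorem eventually_rootProb_le {a : ℝ} {Vn : ℕ → I × I → ℝ} {V : I × I → ℝ} {δ : ℕ → ℝ}
    (hVn : ∀ n, IsBddKernel a (Vn n)) (hV : IsBddKernel a V) (hcut : ∀ n, CutLe (δ n) (Vn n) V)
    (hδ : Tendsto δ atTop (𝓝 0)) (j : ℕ) {ε : ℝ} (hε : 0 < ε) :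
    ∀ᶠ n in atTop, rootProb j (Vn n) ≤ rootProb j V + ε := by
  -- The depth depends only on the limit kernel and is fixed before `n` grows.
  obtain ⟨d, hd⟩ := ((hV.tendsto_integral_survProb j).eventually_lt_const
    (show rootProb j V < rootProb j V + ε / 2 by linarith)).exists
  have hlim : Tendsto (fun n => 2 * δ n + a * ∫ x, |survProb j (Vn n) d x - survProb j V d x|)
      atTop (𝓝 0) := by
    simpa using (hδ.const_mul 2).add
      ((tendsto_integral_abs_survProb_sub hVn hV hcut hδ j d).const_mul a)
  filter_upwards [hlim.eventually_lt_const (half_pos hε)] with n hn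
  have hu := (hVn n).isUnitFun_survProb j d
  have hv := hV.isUnitFun_survProb j d
  have h1 := (hVn n).rootProb_le j d
  have h2 := (hVn n).integral_poissonTail_sub_le hV (j + 1) hu hv
  have h3 := (hcut n).integral_abs_kernelOp_sub_le_add (hVn n) hV hu hv
  have h4 := (abs_integral_le_integral_abs (μ := volume) (f := fun x =>
    poissonTail (j + 1) (kernelOp (Vn n) (survProb j (Vn n) d) x) -
      poissonTail (j + 1) (kernelOp V (survProb j V d) x)))
  rw [integral_sub ((hVn n).isUnitFun_poissonTail _ hu).integrable
    (hV.isUnitFun_poissonTail _ hv).integrable] at h4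
  linarith [le_abs_self ((∫ x, poissonTail (j + 1) (kernelOp (Vn n) (survProb j (Vn n) d) x)) -
    ∫ x, poissonTail (j + 1) (kernelOp V (survProb j V d) x))]

/-! ### Lower bound by removing bad points -/

/-- The points `x ∈ X` removed because `kernelOp V f x`, after earlier removals, fell below `h`. -/
noncomputable def removedSet (V : I × I → ℝ) (f h : I → ℝ) (X : Set I) : ℕ → Set I
  | 0 => ∅
  | i + 1 => {x | x ∈ X ∧ kernelOp V ((removedSet V f h X i)ᶜ.indicator f) x < h x}

theorem measurableSet_removedSet {a : ℝ} {V : I × I → ℝ} (hV : IsBddKernel a V) {f h : I → ℝ}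
    (hf : IsUnitFun f) (hh : Measurable h) {X : Set I} (hX : MeasurableSet X) (i : ℕ) :
    MeasurableSet (removedSet V f h X i) := by
  induction i with
  | zero => exact MeasurableSet.empty
  | succ i ih =>
    exact hX.inter (measurableSet_lt (hV.measurable_kernelOp (hf.indicator ih.compl)) hh)

theorem monotone_removedSet {a : ℝ} {V : I × I → ℝ} (hV : IsBddKernel a V) {f h : I → ℝ}
    (hf : IsUnitFun f) (hh : Measurable h) {X : Set I} (hX : MeasurableSet X) :
    Monotone (removedSet V f h X) := by
  refine monotone_nat_of_le_succ fun i => ?_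
  induction i with
  | zero => exact Set.empty_subset _
  | succ i ih =>
    rintro x ⟨hx, hlt⟩
    refine ⟨hx, lt_of_le_of_lt (hV.kernelOp_mono ?_ ?_ (fun y => ?_) x) hlt⟩
    · exact hf.indicator (measurableSet_removedSet hV hf hh hX _).compl
    · exact hf.indicator (measurableSet_removedSet hV hf hh hX _).compl
    · exact Set.indicator_le_indicator_of_subset (Set.compl_subset_compl.2 ih)
        (fun y => hf.nonneg y) y

/-- If `V` is close to `V'` in the cut norm and `kernelOp V' f ≥ c` on `X`, then after removing a
small set `R` from the support of `f`, `kernelOp V f ≥ s * kernelOp V' f` on the rest of `X`. -/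
theorem CutLe.exists_removable_set {a δ c s : ℝ} {V V' : I × I → ℝ} (hcut : CutLe δ V V')
    (hV : IsBddKernel a V) (hV' : IsBddKernel a V') (hc : 0 < c) (hs : s < 1) {f : I → ℝ}
    (hf : IsUnitFun f) {X : Set I} (hX : MeasurableSet X) (hXc : ∀ x ∈ X, c ≤ kernelOp V' f x)
    (hδ : a * (2 * δ / ((1 - s) * c)) ≤ (1 - s) * c / 2) :
    ∃ R : Set I, MeasurableSet R ∧ volume.real R ≤ 2 * δ / ((1 - s) * c) ∧
      ∀ x ∈ X, x ∉ R → s * kernelOp V' f x ≤ kernelOp V (Rᶜ.indicator f) x := by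
  have hsc : 0 < (1 - s) * c := mul_pos (sub_pos.2 hs) hc
  set η := 2 * δ / ((1 - s) * c) with hη
  have hη0 : 0 ≤ η := by have := hcut.nonneg; positivity
  set R := removedSet V f (fun x => s * kernelOp V' f x) X with hR
  have hh : Measurable fun x => s * kernelOp V' f x := (hV'.measurable_kernelOp hf).const_mul s
  have hRm : ∀ i, MeasurableSet (R i) := measurableSet_removedSet hV hf hh hX
  have hmono : Monotone R := monotone_removedSet hV hf hh hX
  have hsmall : ∀ i, volume.real (R i) ≤ η := by
    intro i
    induction i with
    | zero => simpa [hR, removedSet] using hη0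
    | succ i ih =>
      -- A bad point has total deficit above `(1 - s) c`. The earlier removals account for at most
      -- half of it, by the induction hypothesis and `hδ`; the other half is a discrepancy between
      -- `V'` and `V`.
      have hpt : ∀ x ∈ R (i + 1), (1 - s) * c / 2 ≤ kernelOp V' f x - kernelOp V f x := by
        rintro x ⟨hx, hlt⟩
        have h1 : kernelOp V f x - kernelOp V ((R i)ᶜ.indicator f) x ≤
            a * (1 * volume.real (R i)) := by
          refine hV.kernelOp_sub_indicator_le hf (hf.indicator (hRm i).compl) (hRm i)
            (fun y => ?_) (fun y => Set.indicator_le_self' (fun _ _ => hf.nonneg _) y) x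
          by_cases hy : y ∈ R i
          · simpa [hy] using hf.le_one y
          · simp [hy]
        have h2 : a * (1 * volume.real (R i)) ≤ (1 - s) * c / 2 := by
          rw [one_mul]
          exact (mul_le_mul_of_nonneg_left ih hV.bound_nonneg).trans hδ
        have h3 := mul_le_mul_of_nonneg_left (hXc x hx) (sub_pos.2 hs).le
        have h4 : kernelOp V ((R i)ᶜ.indicator f) x < s * kernelOp V' f x := hlt
        nlinarith
      -- Cut closeness bounds the integrated discrepancy by `δ`, which returns the same bound `η`
      -- for the next stage, with no loss in `i`.
      have h5 : ∫ x in R (i + 1), (1 - s) * c / 2 ≤ δ :=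
        (setIntegral_mono_on (integrable_const _).integrableOn
          ((hV'.integrable_kernelOp hf _).sub (hV.integrable_kernelOp hf _)) (hRm _) hpt).trans
          (hcut.symm.setIntegral_kernelOp_sub_le hV' hV hf (hRm _))
      rw [setIntegral_const, smul_eq_mul] at h5
      rw [hη, le_div_iff₀ hsc]
      linarith
  refine ⟨⋃ i, R i, MeasurableSet.iUnion hRm, ?_, fun x hx hxR => ?_⟩
  · rw [measureReal_def]
    refine ENNReal.toReal_le_of_le_ofReal hη0 ?_
    rw [hmono.measure_iUnion]
    exact iSup_le fun i => (ENNReal.le_ofReal_iff_toReal_le (measure_ne_top _ _) hη0).2 (hsmall i)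
  · have hlim : Tendsto (fun i => kernelOp V ((R i)ᶜ.indicator f) x) atTop
        (𝓝 (kernelOp V ((⋃ i, R i)ᶜ.indicator f) x)) := by
      refine hV.tendsto_kernelOp (fun i => hf.indicator (hRm i).compl) (fun y => ?_) x
      by_cases hy : y ∈ ⋃ i, R i
      · obtain ⟨i, hi⟩ := Set.mem_iUnion.1 hy
        refine tendsto_const_nhds.congr' ?_
        filter_upwards [eventually_ge_atTop i] with m hm
        rw [Set.indicator_of_notMem (Set.notMem_compl_iff.2 hy),
          Set.indicator_of_notMem (Set.notMem_compl_iff.2 (hmono hm hi))]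
      · refine tendsto_const_nhds.congr fun m => ?_
        have : y ∉ R m := fun h => hy (Set.mem_iUnion.2 ⟨m, h⟩)
        rw [Set.indicator_of_mem (Set.mem_compl this), Set.indicator_of_mem (Set.mem_compl hy)]
    -- A point of `X` outside the union passes the test at every stage, hence in the limit.
    refine ge_of_tendsto' hlim fun i => not_lt.1 fun hlt => hxR ?_
    exact Set.mem_iUnion.2 ⟨i + 1, hx, hlt⟩

/-- The sets decrease to the empty set, since zeros of `f` are excluded. Hence the loss from
truncating `f` below `c` is `o(c)`, which a factor `s` can absorb. -/
theorem tendsto_measureReal_pos_lt {f : I → ℝ} (hf : IsUnitFun f) :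
    Tendsto (fun m : ℕ => volume.real {x | 0 < f x ∧ f x < 1 / ((m : ℝ) + 1)}) atTop (𝓝 0) := by
  have h : Tendsto (fun m : ℕ => volume {x | 0 < f x ∧ f x < 1 / ((m : ℝ) + 1)}) atTop
      (𝓝 (volume (⋂ m : ℕ, {x | 0 < f x ∧ f x < 1 / ((m : ℝ) + 1)}))) := by
    refine tendsto_measure_iInter_atTop (fun m => ?_) (fun m n hmn x hx => ⟨hx.1, ?_⟩)
      ⟨0, measure_ne_top _ _⟩
    · exact ((measurableSet_lt measurable_const hf.measurable).inter
        (measurableSet_lt hf.measurable measurable_const)).nullMeasurableSet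
    · exact hx.2.trans_le (one_div_le_one_div_of_le (by positivity) (by gcongr))
  have hempty : (⋂ m : ℕ, {x | 0 < f x ∧ f x < 1 / ((m : ℝ) + 1)}) = ∅ := by
    ext x
    simp only [Set.mem_iInter, Set.mem_ofPred_eq, Set.mem_empty_iff_false, iff_false, not_forall]
    by_cases hx : 0 < f x
    · obtain ⟨m, hm⟩ := exists_nat_one_div_lt hx
      exact ⟨m, fun h => absurd h.2 (not_lt.2 hm.le)⟩
    · exact ⟨0, fun h => hx h.1⟩
  rw [hempty, measure_empty] at h
  simpa [measureReal_def, Function.comp_def] using (ENNReal.tendsto_toReal ENNReal.zero_ne_top).comp h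

/-- The truncated fixed point `g` for `s² V`, with a small set `R` removed, is a subsolution for `Vn
n`; the root integral changes little under truncation, removal and change of kernel. -/
theorem eventually_le_rootProb {a : ℝ} {Vn : ℕ → I × I → ℝ} {V : I × I → ℝ} {δ : ℕ → ℝ}
    (hVn : ∀ n, IsBddKernel a (Vn n)) (hV : IsBddKernel a V) (hcut : ∀ n, CutLe (δ n) (Vn n) V)
    (hδ : Tendsto δ atTop (𝓝 0)) {j : ℕ} (hj : 1 ≤ j) {s : ℝ} (hs0 : 0 < s) (hs1 : s < 1)
    {ε : ℝ} (hε : 0 < ε) :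
    ∀ᶠ n in atTop, rootProb j (fun p => s ^ 2 * V p) ≤ rootProb j (Vn n) + ε := by
  have hsV : IsBddKernel a fun p => s ^ 2 * V p :=
    hV.smul (by positivity) (pow_le_one₀ hs0.le hs1.le)
  set f := survLim j (fun p => s ^ 2 * V p) with hf_def
  have hf : IsUnitFun f := hsV.isUnitFun_survLim j
  have hfix : ∀ x, f x = poissonTail j (s ^ 2 * kernelOp V f x) := fun x => by
    rw [← kernelOp_const_mul]; exact hsV.survLim_eq j x
  have ha := hV.bound_nonneg
  -- Truncation costs at most `a c |Z|` in the operator. The first bound makes this negligible at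
  -- the root, the second makes it at most `(1 - s) c`.
  obtain ⟨c, hc, hcε, hcs⟩ : ∃ c : ℝ, 0 < c ∧ a * c ≤ ε / 2 ∧
      a * volume.real {x | 0 < f x ∧ f x < c} ≤ 1 - s := by
    have h1 : Tendsto (fun m : ℕ => a * (1 / ((m : ℝ) + 1))) atTop (𝓝 0) := by
      simpa using tendsto_one_div_add_atTop_nhds_zero_nat.const_mul a
    have h2 : Tendsto (fun m : ℕ => a * volume.real {x | 0 < f x ∧ f x < 1 / ((m : ℝ) + 1)}) atTop
        (𝓝 0) := by
      simpa using (tendsto_measureReal_pos_lt hf).const_mul a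
    obtain ⟨m, hm1, hm2⟩ := ((h1.eventually_le_const (half_pos hε)).and
      (h2.eventually_le_const (sub_pos.2 hs1))).exists
    exact ⟨1 / ((m : ℝ) + 1), by positivity, hm1, hm2⟩
  set Z := {x | 0 < f x ∧ f x < c} with hZ_def
  have hZ : MeasurableSet Z := (measurableSet_lt measurable_const hf.measurable).inter
    (measurableSet_lt hf.measurable measurable_const)
  set X := {x | c ≤ f x} with hX_def
  have hX : MeasurableSet X := measurableSet_le measurable_const hf.measurable
  set g := X.indicator f with hg_def
  have hg : IsUnitFun g := hf.indicator hX
  have hfg : ∀ x, kernelOp V f x - kernelOp V g x ≤ a * (c * volume.real Z) := by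
    refine hV.kernelOp_sub_indicator_le hf hg hZ (fun y => ?_)
      (fun y => Set.indicator_le_self' (fun _ _ => hf.nonneg _) y)
    by_cases hy : c ≤ f y
    · have hyX : y ∈ X := hy
      simp only [hg_def, Set.indicator_of_mem hyX, sub_self]
      exact Set.indicator_nonneg (fun _ _ => hc.le) y
    · have hyX : y ∉ X := hy
      simp only [hg_def, Set.indicator_of_notMem hyX, sub_zero]
      rcases (hf.nonneg y).eq_or_lt with h0 | h0
      · rw [← h0]; exact Set.indicator_nonneg (fun _ _ => hc.le) y
      · rw [Set.indicator_of_mem (show y ∈ Z from ⟨h0, not_le.1 hy⟩)]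
        exact (not_le.1 hy).le
  -- One factor `s` is spent here: on `X` the operator at `f` is at least `c`, so the truncation
  -- loss is at most a `1 - s` fraction of it.
  have hgX : ∀ x ∈ X, s ^ 2 * kernelOp V f x ≤ s * kernelOp V g x ∧ c ≤ kernelOp V g x := by
    intro x hx
    have h0 := hV.kernelOp_nonneg hf x
    have h1 : c ≤ s ^ 2 * kernelOp V f x := by
      refine le_trans (show c ≤ f x from hx) ?_
      rw [hfix x]
      exact poissonTail_le_self hj (by positivity)
    have hs2 : s ^ 2 ≤ 1 := pow_le_one₀ hs0.le hs1.le
    have h2 : c ≤ kernelOp V f x := by nlinarith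
    have h3 : a * (c * volume.real Z) ≤ (1 - s) * kernelOp V f x := by
      calc a * (c * volume.real Z) = a * volume.real Z * c := by ring
        _ ≤ (1 - s) * kernelOp V f x := mul_le_mul hcs h2 hc.le (sub_pos.2 hs1).le
    have h4 : s * kernelOp V f x ≤ kernelOp V g x := by linarith [hfg x]
    have h5 : s ^ 2 * kernelOp V f x ≤ s * kernelOp V g x := by nlinarith
    refine ⟨h5, ?_⟩
    have h6 := hV.kernelOp_nonneg hg x
    nlinarith
  have hsc : 0 < (1 - s) * c := mul_pos (sub_pos.2 hs1) hc
  have hη : Tendsto (fun n => a * (2 * δ n / ((1 - s) * c))) atTop (𝓝 0) := by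
    simpa using ((hδ.const_mul 2).div_const ((1 - s) * c)).const_mul a
  have hη' : Tendsto (fun n => 2 * δ n + a * (2 * δ n / ((1 - s) * c))) atTop (𝓝 0) := by
    simpa using (hδ.const_mul 2).add hη
  filter_upwards [hη.eventually_le_const (half_pos hsc), hη'.eventually_le_const (half_pos hε)]
    with n hn1 hn2
  obtain ⟨R, hR, hRs, hRX⟩ := (hcut n).exists_removable_set (hVn n) hV hc hs1 hg hX
    (fun x hx => (hgX x hx).2) hn1
  set h := Rᶜ.indicator g with hh_def
  have hh : IsUnitFun h := hg.indicator hR.compl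
  -- The second factor `s` is spent in `hRX`. Off `X \ R` the function `h` vanishes, so only points
  -- of `X \ R` need an argument.
  have hsurv : ∀ x, h x ≤ survLim j (Vn n) x := by
    refine (hVn n).le_survLim j hh fun x => ?_
    by_cases hxR : x ∈ R
    · rw [hh_def, Set.indicator_of_notMem (by simpa using hxR)]
      exact poissonTail_nonneg j ((hVn n).kernelOp_nonneg hh x)
    by_cases hx : x ∈ X
    · rw [hh_def, Set.indicator_of_mem (by simpa using hxR), hg_def, Set.indicator_of_mem hx, hfix x]
      refine poissonTail_mono j (mul_nonneg (by positivity) (hV.kernelOp_nonneg hf x)) ?_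
      exact (hgX x hx).1.trans (hRX x hx hxR)
    · rw [hh_def, Set.indicator_of_mem (by simpa using hxR), hg_def, Set.indicator_of_notMem hx]
      exact poissonTail_nonneg j ((hVn n).kernelOp_nonneg hh x)
  have e1 : ∫ x, poissonTail (j + 1) (kernelOp (Vn n) h x) ≤ rootProb j (Vn n) :=
    integral_mono ((hVn n).isUnitFun_poissonTail _ hh).integrable
      ((hVn n).isUnitFun_poissonTail _ ((hVn n).isUnitFun_survLim j)).integrable fun x =>
      poissonTail_mono _ ((hVn n).kernelOp_nonneg hh x)
        ((hVn n).kernelOp_mono hh ((hVn n).isUnitFun_survLim j) hsurv x)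
  have e2 : rootProb j (fun p => s ^ 2 * V p) ≤
      ∫ x, (poissonTail (j + 1) (kernelOp V g x) + ε / 2) := by
    refine integral_mono (hsV.isUnitFun_poissonTail _ hf).integrable
      ((hV.isUnitFun_poissonTail _ hg).integrable.add (integrable_const _)) fun x => ?_
    have h0 := hV.kernelOp_nonneg hf x
    have hs2 : s ^ 2 ≤ 1 := pow_le_one₀ hs0.le hs1.le
    have h1 : poissonTail (j + 1) (s ^ 2 * kernelOp V f x) ≤ poissonTail (j + 1) (kernelOp V f x) :=
      poissonTail_mono _ (by positivity) (mul_le_of_le_one_left h0 hs2)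
    have h2 := abs_poissonTail_sub_le (j + 1) h0 (hV.kernelOp_nonneg hg x)
    have h3 : kernelOp V g x ≤ kernelOp V f x := hV.kernelOp_mono hg hf
      (fun y => Set.indicator_le_self' (fun _ _ => hf.nonneg _) y) x
    rw [abs_of_nonneg (sub_nonneg.2 h3)] at h2
    have h4 : a * (c * volume.real Z) ≤ ε / 2 := by
      refine le_trans (mul_le_mul_of_nonneg_left ?_ ha) hcε
      exact mul_le_of_le_one_right hc.le measureReal_le_one
    simp only [kernelOp_const_mul]
    linarith [hfg x, le_abs_self (poissonTail (j + 1) (kernelOp V f x) -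
      poissonTail (j + 1) (kernelOp V g x))]
  rw [integral_add (hV.isUnitFun_poissonTail _ hg).integrable (integrable_const _)] at e2
  have e3 := (hVn n).integral_poissonTail_sub_le hV (j + 1) hh hg
  have e4 := (hcut n).integral_abs_kernelOp_sub_le_add (hVn n) hV hh hg
  have e5 : ∫ x, |h x - g x| ≤ volume.real R := by
    calc ∫ x, |h x - g x| ≤ ∫ x, R.indicator (fun _ => (1 : ℝ)) x := by
          refine integral_mono (hh.integrable.sub hg.integrable).abs
            ((integrable_const 1).indicator hR) fun x => ?_
          by_cases hx : x ∈ R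
          · simpa [hh_def, hx] using hg.abs_le_one x
          · simp [hh_def, hx]
      _ = volume.real R := by simp [integral_indicator hR]
  have e6 := abs_integral_le_integral_abs (μ := volume) (f := fun x =>
    poissonTail (j + 1) (kernelOp (Vn n) h x) - poissonTail (j + 1) (kernelOp V g x))
  rw [integral_sub ((hVn n).isUnitFun_poissonTail _ hh).integrable
    (hV.isUnitFun_poissonTail _ hg).integrable] at e6
  have e7 := mul_le_mul_of_nonneg_left (e5.trans hRs) ha
  have e8 : ∫ _ : I, ε / 2 = ε / 2 := by simp
  rw [e8] at e2
  linarith [neg_abs_le ((∫ x, poissonTail (j + 1) (kernelOp (Vn n) h x)) -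
    ∫ x, poissonTail (j + 1) (kernelOp V g x))]

/-! ### Levels of a uniform variable -/

theorem volume_setOf_ofReal_le {p : ℝ≥0∞} (hp : p ≤ 1) :
    volume {u : I | ENNReal.ofReal u ≤ p} = p := by
  have hp' : p ≠ ∞ := (hp.trans_lt ENNReal.one_lt_top).ne
  have hpI : p.toReal ∈ I := ⟨ENNReal.toReal_nonneg, ENNReal.toReal_le_of_le_ofReal zero_le_one
    (by simpa using hp)⟩
  have : {u : I | ENNReal.ofReal u ≤ p} = Set.Iic ⟨p.toReal, hpI⟩ := by
    ext u
    exact ENNReal.ofReal_le_iff_le_toReal hp'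
  rw [this, unitInterval.volume_Iic]
  exact ENNReal.ofReal_toReal hp'

/-! ### Sampling the number of children -/

theorem poissonMeasure_Iic (r : ℝ≥0) (i : ℕ) :
    poissonMeasure r (Set.Iic i) = ∑ l ∈ Finset.Iic i,
      ENNReal.ofReal (Real.exp (-r) * r ^ l / (l.factorial : ℝ)) := by
  rw [← Finset.coe_Iic, ← sum_measure_singleton]
  simp only [poissonMeasure_singleton]

theorem measurable_poissonMeasure_Iic (i : ℕ) :
    Measurable fun r : ℝ≥0 => poissonMeasure r (Set.Iic i) := by
  simp only [poissonMeasure_Iic]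
  fun_prop

/-- The existence clause is needed because `sInf ∅ = 0` in `ℕ`: for `r > 0` the level `u = 1` is
never reached and the quantile is `0`. -/
theorem lt_poissonQuantile_iff (r : ℝ≥0) (u : I) (i : ℕ) :
    i < poissonQuantile r u ↔ (∃ m : ℕ, ENNReal.ofReal u ≤ poissonMeasure r (Set.Iic m)) ∧
      poissonMeasure r (Set.Iic i) < ENNReal.ofReal u := by
  constructor
  · intro h
    refine ⟨Nat.nonempty_of_pos_sInf (Nat.zero_lt_of_lt h), not_le.1 fun h' => ?_⟩
    exact Nat.notMem_of_lt_sInf h h'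
  · rintro ⟨hne, h⟩
    refine not_le.1 fun h' => not_le.2 h ?_
    exact (Nat.sInf_mem (s := {m : ℕ | ENNReal.ofReal u ≤ poissonMeasure r (Set.Iic m)}) hne).trans
      (measure_mono (Set.Iic_subset_Iic.2 h'))

theorem measurable_poissonQuantile : Measurable fun p : ℝ≥0 × I => poissonQuantile p.1 p.2 := by
  refine measurable_of_Ioi fun i => ?_
  have h1 : ∀ m, Measurable fun p : ℝ≥0 × I => poissonMeasure p.1 (Set.Iic m) := fun m =>
    (measurable_poissonMeasure_Iic m).comp measurable_fst
  have h2 : Measurable fun p : ℝ≥0 × I => ENNReal.ofReal p.2 := by fun_prop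
  have : (fun p : ℝ≥0 × I => poissonQuantile p.1 p.2) ⁻¹' Set.Ioi i =
      (⋃ m : ℕ, {p | ENNReal.ofReal p.2 ≤ poissonMeasure p.1 (Set.Iic m)}) ∩
        {p | poissonMeasure p.1 (Set.Iic i) < ENNReal.ofReal p.2} := by
    ext p
    simp [lt_poissonQuantile_iff]
  rw [this]
  exact (MeasurableSet.iUnion fun m => measurableSet_le h2 (h1 m)).inter (measurableSet_lt (h1 i) h2)

theorem exists_le_poissonMeasure_Iic (r : ℝ≥0) {u : I} (hu : u < 1) :
    ∃ m : ℕ, ENNReal.ofReal u ≤ poissonMeasure r (Set.Iic m) := by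
  have h := tendsto_measure_iUnion_atTop (μ := poissonMeasure r)
    (s := fun m : ℕ => Set.Iic m) fun _ _ h => Set.Iic_subset_Iic.2 h
  have hU : (⋃ m : ℕ, Set.Iic m) = Set.univ :=
    Set.eq_univ_of_forall fun m => Set.mem_iUnion.2 ⟨m, Set.mem_Iic.2 le_rfl⟩
  rw [hU, measure_univ] at h
  have hu' : ENNReal.ofReal u < 1 := by
    rw [← ENNReal.ofReal_one]
    exact (ENNReal.ofReal_lt_ofReal_iff zero_lt_one).2 hu
  exact (h.eventually_const_le hu').exists

theorem map_poissonQuantile (r : ℝ≥0) :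
    (volume : Measure I).map (poissonQuantile r) = poissonMeasure r := by
  have hm : Measurable (poissonQuantile r) :=
    Measurable.of_uncurry_left (f := poissonQuantile) measurable_poissonQuantile
  have : IsProbabilityMeasure ((volume : Measure I).map (poissonQuantile r)) :=
    Measure.isProbabilityMeasure_map hm.aemeasurable
  refine Measure.ext_of_Iic _ _ fun i => ?_
  rw [Measure.map_apply hm measurableSet_Iic]
  have hle : poissonMeasure r (Set.Iic i) ≤ 1 := prob_le_one
  refine Eq.trans (measure_congr ?_) (volume_setOf_ofReal_le hle)
  -- Only the level `1` can give the default value, and it is null.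
  have h1 : ∀ᵐ u : I, u ≠ 1 := by simp [ae_iff]
  filter_upwards [h1] with u hu
  refine propext ?_
  change poissonQuantile r u ≤ i ↔ ENNReal.ofReal u ≤ _
  rw [← not_iff_not, not_le, not_le, lt_poissonQuantile_iff]
  exact and_iff_right (exists_le_poissonMeasure_Iic r (lt_of_le_of_ne u.2.2 hu))

/-! ### Sampling the type of a child -/

namespace Graphon

variable (W : Graphon)

theorem measurable_intensity (A : Set I) :
    Measurable fun x => W.intensity x A := by
  have : Measurable fun p : I × I => (W p : ℝ≥0∞) := W.measurable'.coe_nnreal_ennreal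
  exact this.lintegral_prod_right' (ν := volume.restrict A)

theorem intensity_mono (x : I) {A B : Set I} (h : A ⊆ B) : W.intensity x A ≤ W.intensity x B :=
  lintegral_mono_set h

theorem intensity_eq_withDensity (x : I) {A : Set I} (hA : MeasurableSet A) :
    W.intensity x A = volume.withDensity (fun y => (W (x, y) : ℝ≥0∞)) A :=
  (withDensity_apply _ hA).symm

/-- The strict form needs no finiteness of the intensity, so it yields measurability at all types.
-/
theorem childType_lt_iff (x u t : I) : W.childType x u < t ↔
    ∃ s < t, ENNReal.ofReal u * W.intensity x Set.univ ≤ W.intensity x (Set.Iic s) := by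
  rw [childType, sInf_lt_iff]
  exact exists_congr fun s => and_comm

theorem measurable_childType : Measurable fun p : I × I => W.childType p.1 p.2 := by
  refine measurable_of_Iio fun t => ?_
  -- Monotonicity of the distribution function reduces the witness `s` to a rational one.
  have : (fun p : I × I => W.childType p.1 p.2) ⁻¹' Set.Iio t =
      ⋃ (q : ℚ) (hq : (q : ℝ) ∈ I) (_ : (q : ℝ) ≤ t ∧ (⟨q, hq⟩ : I) < t),
        {p : I × I | ENNReal.ofReal p.2 * W.intensity p.1 Set.univ ≤
          W.intensity p.1 (Set.Iic ⟨q, hq⟩)} := by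
    ext p
    simp only [Set.mem_preimage, Set.mem_Iio, childType_lt_iff, Set.mem_iUnion, Set.mem_ofPred_eq]
    constructor
    · rintro ⟨s, hst, hs⟩
      obtain ⟨q, hsq, hqt⟩ := exists_rat_btwn (show (s : ℝ) < t from hst)
      refine ⟨q, ⟨s.2.1.trans hsq.le, hqt.le.trans t.2.2⟩, ⟨hqt.le, hqt⟩, hs.trans ?_⟩
      exact W.intensity_mono _ (Set.Iic_subset_Iic.2 hsq.le)
    · rintro ⟨q, hq, h, hs⟩
      exact ⟨⟨q, hq⟩, h.2, hs⟩
  rw [this]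
  refine MeasurableSet.iUnion fun q => MeasurableSet.iUnion fun hq => MeasurableSet.iUnion fun _ => ?_
  have h2 : Measurable fun p : I × I => ENNReal.ofReal p.2 := by fun_prop
  exact measurableSet_le (h2.mul ((W.measurable_intensity _).comp measurable_fst))
    ((W.measurable_intensity _).comp measurable_fst)

/-- The infimum is attained because the distribution function of a finite measure is
right-continuous. The endpoint `t = 1` has no right neighbourhood and is treated separately. -/
theorem childType_le_iff {x : I} (hx : W.intensity x Set.univ ≠ ∞) (u t : I) :
    W.childType x u ≤ t ↔
      ENNReal.ofReal u * W.intensity x Set.univ ≤ W.intensity x (Set.Iic t) := by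
  refine ⟨fun h => ?_, fun h => sInf_le h⟩
  rcases t.2.2.eq_or_lt with ht | ht
  · have : Set.Iic t = Set.univ := Set.eq_univ_of_forall fun y => y.2.2.trans ht.ge
    rw [this]
    exact mul_le_of_le_one_left' (ENNReal.ofReal_le_one.2 u.2.2)
  · have : NeBot (𝓝[>] t) := nhdsGT_neBot_of_exists_gt ⟨1, ht⟩
    have hlim := tendsto_measure_biInter_gt (μ := volume.withDensity fun y => (W (x, y) : ℝ≥0∞))
      (s := fun s : I => Set.Iic s) (a := t) (fun _ _ => measurableSet_Iic.nullMeasurableSet)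
      (fun _ _ _ h => Set.Iic_subset_Iic.2 h) ⟨1, ht, ?_⟩
    · have hI : (⋂ s > t, Set.Iic s) = Set.Iic t := by
        ext y
        simp only [Set.mem_iInter, Set.mem_Iic]
        exact ⟨fun h => le_of_forall_gt_imp_ge_of_dense h, fun h s hs => h.trans (le_of_lt hs)⟩
      rw [hI] at hlim
      rw [W.intensity_eq_withDensity x measurableSet_Iic]
      refine ge_of_tendsto hlim ?_
      filter_upwards [self_mem_nhdsWithin] with s hs
      obtain ⟨s', hs's, hs'⟩ := (W.childType_lt_iff x u s).1 (h.trans_lt hs)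
      rw [Function.comp_apply, ← W.intensity_eq_withDensity x measurableSet_Iic]
      exact hs'.trans (W.intensity_mono x (Set.Iic_subset_Iic.2 hs's.le))
    · rw [← W.intensity_eq_withDensity x measurableSet_Iic]
      exact ne_top_of_le_ne_top hx (W.intensity_mono x (Set.subset_univ _))

/-- Multiplying by the total mass instead of normalising covers types of zero intensity, whose child
type is irrelevant. -/
theorem smul_map_childType {x : I} (hx : W.intensity x Set.univ ≠ ∞) :
    W.intensity x Set.univ • (volume : Measure I).map (W.childType x) =
      volume.withDensity fun y => (W (x, y) : ℝ≥0∞) := by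
  have hm : Measurable (W.childType x) := W.measurable_childType.comp measurable_prodMk_left
  have hp : IsProbabilityMeasure ((volume : Measure I).map (W.childType x)) :=
    Measure.isProbabilityMeasure_map hm.aemeasurable
  have : IsFiniteMeasure (W.intensity x Set.univ • (volume : Measure I).map (W.childType x)) :=
    Measure.smul_finite _ hx
  refine Measure.ext_of_Iic _ _ fun t => ?_
  rw [← W.intensity_eq_withDensity x measurableSet_Iic, Measure.smul_apply, smul_eq_mul,
    Measure.map_apply hm measurableSet_Iic]
  have hle := W.intensity_mono x (Set.subset_univ (Set.Iic t))
  by_cases h0 : W.intensity x Set.univ = 0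
  · rw [h0, zero_mul]
    exact (le_antisymm (hle.trans h0.le) (zero_le)).symm
  · have : W.childType x ⁻¹' Set.Iic t =
        {u : I | ENNReal.ofReal u ≤ W.intensity x (Set.Iic t) / W.intensity x Set.univ} := by
      ext u
      rw [Set.mem_preimage, Set.mem_Iic, W.childType_le_iff hx, Set.mem_ofPred_eq,
        ENNReal.le_div_iff_mul_le (Or.inl h0) (Or.inl hx)]
    rw [this, volume_setOf_ofReal_le (ENNReal.div_le_of_le_mul (by simpa using hle)),
      ENNReal.mul_div_cancel h0 hx]

/-- The mean offspring number times the average of `f` over the type of a child is the integral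
of `f` against the intensity. -/
theorem toReal_intensity_mul_integral_childType {x : I} (hx : W.intensity x Set.univ ≠ ∞)
    {f : I → ℝ} (hf : Measurable f) :
    (W.intensity x Set.univ).toReal * ∫ u, f (W.childType x u) = ∫ y, (W (x, y) : ℝ) * f y := by
  have hm : Measurable (W.childType x) := W.measurable_childType.comp measurable_prodMk_left
  rw [← integral_map (f := f) hm.aemeasurable hf.aestronglyMeasurable, ← smul_eq_mul,
    ← integral_smul_measure, W.smul_map_childType hx,
    integral_withDensity_eq_integral_smul (f := fun y => W (x, y))
      (W.measurable'.comp measurable_prodMk_left)]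
  rfl

end Graphon

/-! ### Poisson thinning -/

/-- The probability of exactly `l` successes in `n` trials. -/
noncomputable def binomialProb (p : ℝ) (l n : ℕ) : ℝ := n.choose l * p ^ l * (1 - p) ^ (n - l)

theorem hasSum_poisson_mul_binomialProb (m p : ℝ) (l : ℕ) :
    HasSum (fun n : ℕ => Real.exp (-m) * m ^ n / (n.factorial : ℝ) * binomialProb p l n)
      (Real.exp (-(m * p)) * (m * p) ^ l / (l.factorial : ℝ)) := by
  -- Terms with `n < l` vanish; after the shift the binomial coefficient cancels `n!` and leaves the
  -- exponential series of `m (1 - p)`.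
  rw [← hasSum_nat_add_iff' l]
  have h0 : ∑ n ∈ Finset.range l,
      Real.exp (-m) * m ^ n / (n.factorial : ℝ) * binomialProb p l n = 0 :=
    Finset.sum_eq_zero fun n hn => by
      simp [binomialProb, Nat.choose_eq_zero_of_lt (Finset.mem_range.1 hn)]
  rw [h0, sub_zero]
  have h1 : HasSum (fun n : ℕ => (m * (1 - p)) ^ n / (n.factorial : ℝ)) (Real.exp (m * (1 - p))) := by
    rw [Real.exp_eq_exp_ℝ]
    exact NormedSpace.expSeries_div_hasSum_exp (m * (1 - p))
  convert! h1.mul_left (Real.exp (-m) * (m * p) ^ l / (l.factorial : ℝ)) using 1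
  · ext n
    have h2 : ((n + l).choose l : ℝ) * (n.factorial * l.factorial) = ((n + l).factorial : ℝ) := by
      have := Nat.add_choose_mul_factorial_mul_factorial n l
      rw [← this]
      push_cast
      ring
    have h3 : ((n + l).factorial : ℝ) ≠ 0 := by positivity
    have h4 : (n.factorial : ℝ) ≠ 0 := by positivity
    have h5 : (l.factorial : ℝ) ≠ 0 := by positivity
    rw [binomialProb, Nat.add_sub_cancel, mul_pow, mul_pow, pow_add]
    field_simp
    rw [← h2]
    ring
  · have : Real.exp (-(m * p)) = Real.exp (-m) * Real.exp (m * (1 - p)) := by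
      rw [← Real.exp_add]; congr 1; ring
    rw [this]
    ring

theorem integral_poissonMeasure_one_sub_binomialProb (m : ℝ≥0) {p : ℝ} (hp0 : 0 ≤ p) (hp1 : p ≤ 1)
    (j : ℕ) :
    ∫ n, (1 - ∑ l ∈ Finset.range j, binomialProb p l n) ∂(poissonMeasure m) =
      poissonTail j (m * p) := by
  have hi : ∀ l, Integrable (binomialProb p l) (poissonMeasure m) := fun l => by
    rw [integrable_poissonMeasure_iff]
    refine (hasSum_poisson_mul_binomialProb m p l).summable.congr fun n => ?_
    rw [Real.norm_of_nonneg]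
    have := sub_nonneg.2 hp1
    unfold binomialProb
    positivity
  rw [integral_sub (integrable_const _) (integrable_finsetSum _ fun l _ => hi l),
    integral_finsetSum _ fun l _ => hi l, poissonTail]
  congr 1
  · simp
  · refine Finset.sum_congr rfl fun l _ => ?_
    rw [integral_poissonMeasure]
    exact (hasSum_poisson_mul_binomialProb m p l).tsum_eq

theorem measureReal_infinitePi_filter_eq {Ω : Type*} [MeasurableSpace Ω] (μ : Measure Ω)
    [IsProbabilityMeasure μ] {E : Set Ω} (hE : MeasurableSet E) {n : ℕ} {S : Finset ℕ}
    (hS : S ⊆ Finset.range n) :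
    (Measure.infinitePi fun _ : ℕ => μ).real {η | ∀ i < n, η i ∈ E ↔ i ∈ S} =
      μ.real E ^ S.card * (1 - μ.real E) ^ (n - S.card) := by
  classical
  have h : {η : ℕ → Ω | ∀ i < n, η i ∈ E ↔ i ∈ S} =
      Set.pi (Finset.range n : Set ℕ) fun i => if i ∈ S then E else Eᶜ := by
    ext η
    simp only [Set.mem_ofPred_eq, Set.mem_pi, Finset.coe_range, Set.mem_Iio]
    refine forall₂_congr fun i _ => ?_
    by_cases hi : i ∈ S <;> simp [hi]
  rw [h, measureReal_def, Measure.infinitePi_pi _ fun i _ => by split_ifs; exacts [hE, hE.compl],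
    ENNReal.toReal_prod]
  have h2 : ∀ i ∈ Finset.range n, (μ (if i ∈ S then E else Eᶜ)).toReal =
      if i ∈ S then μ.real E else 1 - μ.real E := fun i _ => by
    split_ifs
    · rfl
    · exact probReal_compl_eq_one_sub hE
  rw [Finset.prod_congr rfl h2, Finset.prod_ite, Finset.prod_const, Finset.prod_const,
    Finset.filter_mem_eq_inter, Finset.inter_eq_right.2 hS, Finset.filter_notMem_eq_sdiff,
    Finset.card_sdiff_of_subset hS, Finset.card_range]

theorem sum_range_choose_mul_ite (n j : ℕ) (g : ℕ → ℝ) :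
    ∑ m ∈ Finset.range (n + 1), n.choose m • (if m < j then g m else 0) =
      ∑ l ∈ Finset.range j, n.choose l * g l := by
  have h1 : ∑ m ∈ Finset.range (n + 1), n.choose m • (if m < j then g m else 0) =
      ∑ m ∈ Finset.range (n + 1 + j), n.choose m • (if m < j then g m else 0) :=
    Finset.sum_subset (Finset.range_subset_range.2 (by omega)) fun m _ hm => by
      rw [Nat.choose_eq_zero_of_lt (by simpa using hm), zero_smul]
  have h2 : ∑ l ∈ Finset.range j, n.choose l • (if l < j then g l else 0) =
      ∑ m ∈ Finset.range (n + 1 + j), n.choose m • (if m < j then g m else 0) :=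
    Finset.sum_subset (Finset.range_subset_range.2 (by omega)) fun m _ hm => by
      rw [if_neg (by simpa using hm), smul_zero]
  rw [h1, ← h2]
  exact Finset.sum_congr rfl fun l hl => by simp [Finset.mem_range.1 hl]

theorem measurableSet_exists_card {Ω : Type*} [MeasurableSpace Ω] {E : Set Ω}
    (hE : MeasurableSet E) (n j : ℕ) :
    MeasurableSet {η : ℕ → Ω | ∃ S : Finset ℕ, S.card = j ∧ ∀ i ∈ S, i < n ∧ η i ∈ E} := by
  have : {η : ℕ → Ω | ∃ S : Finset ℕ, S.card = j ∧ ∀ i ∈ S, i < n ∧ η i ∈ E} =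
      ⋃ (S : Finset ℕ) (_ : S.card = j), ⋂ i ∈ S, {η | i < n ∧ η i ∈ E} := by
    ext η; simp
  rw [this]
  refine MeasurableSet.iUnion fun S => MeasurableSet.iUnion fun _ =>
    S.measurableSet_biInter fun i _ => ?_
  exact (MeasurableSet.const _).inter (measurable_pi_apply i hE)

/-- The complement is the disjoint union, over sets `S` of fewer than `j` indices below `n`, of the
events that the successes are exactly `S`; grouping by cardinality gives binomial masses. -/
theorem measureReal_exists_card {Ω : Type*} [MeasurableSpace Ω] (μ : Measure Ω)
    [IsProbabilityMeasure μ] {E : Set Ω} (hE : MeasurableSet E) (n j : ℕ) :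
    (Measure.infinitePi fun _ : ℕ => μ).real
      {η | ∃ S : Finset ℕ, S.card = j ∧ ∀ i ∈ S, i < n ∧ η i ∈ E} =
      1 - ∑ l ∈ Finset.range j, binomialProb (μ.real E) l n := by
  classical
  set T := (Finset.range n).powerset.filter fun S => S.card < j with hT
  have hcompl : {η : ℕ → Ω | ∃ S : Finset ℕ, S.card = j ∧ ∀ i ∈ S, i < n ∧ η i ∈ E}ᶜ =
      ⋃ S ∈ T, {η | ∀ i < n, η i ∈ E ↔ i ∈ S} := by
    ext η
    simp only [Set.mem_compl_iff, Set.mem_ofPred_eq, Set.mem_iUnion, exists_prop]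
    set S₀ := (Finset.range n).filter fun i => η i ∈ E with hS₀
    constructor
    · intro h
      refine ⟨S₀, ?_, fun i hi => by simp [hS₀, hi]⟩
      simp only [hT, Finset.mem_filter, Finset.mem_powerset]
      refine ⟨Finset.filter_subset _ _, not_le.1 fun hle => h ?_⟩
      obtain ⟨S, hS, hc⟩ := Finset.exists_subset_card_eq hle
      exact ⟨S, hc, fun i hi => by simpa [hS₀] using hS hi⟩
    · rintro ⟨S, hS, hSη⟩ ⟨S', hc, hS'⟩
      simp only [hT, Finset.mem_filter, Finset.mem_powerset] at hS
      have : S' ⊆ S := fun i hi => (hSη i (hS' i hi).1).1 (hS' i hi).2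
      exact absurd (Finset.card_le_card this) (by omega)
  have hmeas : ∀ S : Finset ℕ, MeasurableSet {η : ℕ → Ω | ∀ i < n, η i ∈ E ↔ i ∈ S} := fun S => by
    have : {η : ℕ → Ω | ∀ i < n, η i ∈ E ↔ i ∈ S} =
        ⋂ (i : ℕ) (_ : i < n), {η | η i ∈ E ↔ i ∈ S} := by ext; simp
    rw [this]
    refine MeasurableSet.iInter fun i => MeasurableSet.iInter fun _ => ?_
    by_cases hi : i ∈ S
    · simp only [hi, iff_true]
      exact measurable_pi_apply i hE
    · simp only [hi, iff_false]
      exact (measurable_pi_apply i : Measurable fun η : ℕ → Ω => η i) hE.compl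
  have h1 := probReal_compl_eq_one_sub (μ := Measure.infinitePi fun _ : ℕ => μ)
    (measurableSet_exists_card hE n j)
  rw [hcompl, measureReal_biUnion_finset (fun S hS S' hS' hne => ?_) fun S _ => hmeas S] at h1
  · have h2 : ∑ S ∈ T, (Measure.infinitePi fun _ : ℕ => μ).real {η | ∀ i < n, η i ∈ E ↔ i ∈ S} =
        ∑ l ∈ Finset.range j, binomialProb (μ.real E) l n := by
      simp only [binomialProb, mul_assoc]
      rw [← sum_range_choose_mul_ite n j fun l => μ.real E ^ l * (1 - μ.real E) ^ (n - l)]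
      have := Finset.sum_powerset_apply_card (fun l => if l < j then
        μ.real E ^ l * (1 - μ.real E) ^ (n - l) else 0) (x := Finset.range n)
      rw [Finset.card_range] at this
      rw [← this, hT, Finset.sum_filter]
      refine Finset.sum_congr rfl fun S hS => ?_
      split_ifs
      · exact measureReal_infinitePi_filter_eq μ hE (Finset.mem_powerset.1 hS)
      · rfl
    linarith
  · refine Set.disjoint_left.2 fun η h h' => hne ?_
    simp only [hT, Finset.coe_filter, Set.mem_ofPred_eq, Finset.mem_powerset] at hS hS'
    ext i
    constructor
    · intro hi
      have hin := Finset.mem_range.1 (hS.1 hi)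
      exact (h' i hin).1 ((h i hin).2 hi)
    · intro hi
      have hin := Finset.mem_range.1 (hS'.1 hi)
      exact (h i hin).1 ((h' i hin).2 hi)

/-! ### Decomposing the randomness at the root -/

theorem map_prod_infinitePi_option {X ι : Type*} [MeasurableSpace X] (μ : Measure X)
    [IsProbabilityMeasure μ] :
    (μ.prod (Measure.infinitePi fun _ : ι => μ)).map (fun p (o : Option ι) => o.elim p.1 p.2) =
      Measure.infinitePi fun _ : Option ι => μ := by
  classical
  have hm : Measurable fun (p : X × (ι → X)) (o : Option ι) => o.elim p.1 p.2 := by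
    refine measurable_pi_lambda _ fun o => ?_
    cases o with
    | none => exact measurable_fst
    | some i => exact (measurable_pi_apply i).comp measurable_snd
  refine Measure.eq_infinitePi _ fun s t ht => ?_
  rw [Measure.map_apply hm (MeasurableSet.pi s.countable_toSet fun i _ => ht i)]
  have hpre : (fun (p : X × (ι → X)) (o : Option ι) => o.elim p.1 p.2) ⁻¹' Set.pi s t =
      (if none ∈ s then t none else Set.univ) ×ˢ
        Set.pi (Finset.eraseNone s : Set ι) fun i => t (some i) := by
    ext p
    simp only [Set.mem_preimage, Set.mem_pi, SetLike.mem_coe, Set.mem_prod, Finset.mem_eraseNone,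
      Option.forall, Option.elim_none, Option.elim_some]
    by_cases h : none ∈ s <;> simp [h]
  rw [hpre, Measure.prod_prod, Measure.infinitePi_pi _ fun i _ => ht (some i)]
  by_cases h : none ∈ s
  · have hs : s = Finset.insertNone (Finset.eraseNone s) := by
      rw [Finset.insertNone_eraseNone, Finset.insert_eq_of_mem h]
    conv_rhs => rw [hs, Finset.prod_insertNone]
    simp [h]
  · have hs : s = (Finset.eraseNone s).map Function.Embedding.some := by
      rw [Finset.map_some_eraseNone, Finset.erase_eq_of_notMem h]
    conv_rhs => rw [hs, Finset.prod_map]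
    simp [h]

theorem map_infinitePi_option {X ι : Type*} [MeasurableSpace X] (μ : Measure X)
    [IsProbabilityMeasure μ] :
    (Measure.infinitePi fun _ : Option ι => μ).map (fun ω => (ω none, fun i => ω (some i))) =
      μ.prod (Measure.infinitePi fun _ : ι => μ) := by
  have hm : Measurable fun (p : X × (ι → X)) (o : Option ι) => o.elim p.1 p.2 := by
    refine measurable_pi_lambda _ fun o => ?_
    cases o with
    | none => exact measurable_fst
    | some i => exact (measurable_pi_apply i).comp measurable_snd
  rw [← map_prod_infinitePi_option, Measure.map_map (by fun_prop) hm]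
  exact Measure.map_id

instance : IsProbabilityMeasure noiseMeasure :=
  inferInstanceAs (IsProbabilityMeasure (Measure.infinitePi fun _ : List ℕ => _))

/-- The randomness of the subtree of the child number `i` of the root. -/
def Noise.child (ω : Noise) (i : ℕ) : Noise := fun v => ω (v ++ [i])

theorem measurable_noise_child (i : ℕ) : Measurable fun ω : Noise => ω.child i :=
  measurable_pi_lambda _ fun _ => measurable_pi_apply _

/-- The randomness at the root and in the subtrees of its children is independent, and each subtree
has the same randomness as the whole tree. -/
theorem map_noise_root_children :
    noiseMeasure.map (fun ω : Noise => (ω [], fun i => ω.child i)) =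
      (volume : Measure (I × I)).prod (Measure.infinitePi fun _ : ℕ => noiseMeasure) := by
  -- A word is empty or ends in the label of a child of the root, since newer generations are put in
  -- front.
  let e : Option (ℕ × List ℕ) → List ℕ := fun o => o.elim [] fun q => q.2 ++ [q.1]
  have he : Function.Injective e := by
    rintro (_ | ⟨i, v⟩) (_ | ⟨i', v'⟩) h
    · rfl
    · simp [e] at h
    · simp [e] at h
    · simp only [e, Option.elim_some] at h
      obtain ⟨h1, h2⟩ := List.append_inj' h rfl
      simp only [List.cons.injEq, and_true] at h2
      rw [h1, h2]
  have h1 := Measure.map_infinitePi_infinitePi_of_inj (Ω := fun _ : List ℕ => I × I)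
    (P := fun _ => volume) he
  have h2 := map_infinitePi_option (ι := ℕ × List ℕ) (volume : Measure (I × I))
  have h3 := Measure.infinitePi_map_curry (ι := ℕ) (κ := List ℕ)
    fun _ _ => (volume : Measure (I × I))
  have h4 := Measure.map_prod_map (volume : Measure (I × I))
    (Measure.infinitePi fun _ : ℕ × List ℕ => (volume : Measure (I × I))) measurable_id
    (MeasurableEquiv.curry ℕ (List ℕ) (I × I)).measurable
  rw [h3, Measure.map_id, ← h2, ← h1, Measure.map_map (by fun_prop) (by fun_prop),
    Measure.map_map (by fun_prop) (by fun_prop)] at h4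
  exact h4.symm

attribute [local irreducible] poissonQuantile

/-! ### The branching process started from a particle of a given type -/

theorem propertyB_append (k : ℕ) (N : List ℕ → ℕ) (d i : ℕ) (v : List ℕ) :
    PropertyB k N d (v ++ [i]) ↔ PropertyB k (fun w => N (w ++ [i])) d v := by
  induction d generalizing v with
  | zero => exact Iff.rfl
  | succ d ih =>
    refine exists_congr fun S => and_congr_right fun _ => forall₂_congr fun l _ => ?_
    exact and_congr_right fun _ => ih (l :: v)

theorem propertyB_of_succ {k : ℕ} {N : List ℕ → ℕ} (d : ℕ) {v : List ℕ}
    (h : PropertyB k N (d + 1) v) : PropertyB k N d v := by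
  induction d generalizing v with
  | zero => trivial
  | succ d ih =>
    obtain ⟨S, hS, h⟩ := h
    exact ⟨S, hS, fun i hi => ⟨(h i hi).1, ih (h i hi).2⟩⟩

theorem propertyA_of_succ {k : ℕ} {N : List ℕ → ℕ} (d : ℕ) (h : PropertyA k N (d + 1)) :
    PropertyA k N d := by
  cases d with
  | zero => trivial
  | succ d =>
    obtain ⟨S, hS, h⟩ := h
    exact ⟨S, hS, fun i hi => ⟨(h i hi).1, propertyB_of_succ d (h i hi).2⟩⟩

namespace Graphon

variable (W : Graphon)

/-- The types in the branching process started from a particle of type `x`. -/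
noncomputable def rootedType (x : I) (ω : Noise) : List ℕ → I
  | [] => x
  | i :: v => W.childType (rootedType x ω v) (ω (i :: v)).1

/-- The expected number of children of a particle of type `x`. -/
noncomputable def meanOffspring (x : I) : ℝ≥0 := (W.intensity x Set.univ).toNNReal

/-- The offspring numbers in the branching process started from a particle of type `x`. -/
noncomputable def rootedNum (x : I) (ω : Noise) (v : List ℕ) : ℕ :=
  poissonQuantile (W.meanOffspring (W.rootedType x ω v)) (ω v).2

theorem particleType_eq (ω : Noise) (v : List ℕ) :
    W.particleType ω v = W.rootedType (ω []).1 ω v := by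
  induction v with
  | nil => rfl
  | cons i v ih => rw [particleType, rootedType, ih]

theorem numChildren_eq (ω : Noise) : W.numChildren ω = W.rootedNum (ω []).1 ω := by
  ext v
  rw [numChildren, particleType_eq]
  rfl

/-- Self-similarity: the subtree of child `i` is the same construction run from that child's type
with its own randomness. -/
theorem rootedType_append (x : I) (ω : Noise) (i : ℕ) (v : List ℕ) :
    W.rootedType x ω (v ++ [i]) = W.rootedType (W.childType x (ω.child i []).1) (ω.child i) v := by
  induction v with
  | nil => rfl
  | cons l v ih =>
    rw [List.cons_append, rootedType, rootedType, ih]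
    rfl

theorem rootedNum_append (x : I) (ω : Noise) (i : ℕ) (v : List ℕ) :
    W.rootedNum x ω (v ++ [i]) = W.rootedNum (W.childType x (ω.child i []).1) (ω.child i) v := by
  rw [rootedNum, rootedNum, rootedType_append]
  rfl

/-- The root, of type `q.1`, has at least `j` children for which the event `D` occurs. -/
def offspringEvent (j : ℕ) (D : Set (I × Noise)) : Set (I × Noise) :=
  {q | ∃ S : Finset ℕ, S.card = j ∧ ∀ i ∈ S, i < poissonQuantile (W.meanOffspring q.1) (q.2 []).2 ∧
    (W.childType q.1 (q.2.child i []).1, q.2.child i) ∈ D}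

/-- The root, of type `q.1`, has property `𝓑_d`. -/
def survEvent (j : ℕ) : ℕ → Set (I × Noise)
  | 0 => Set.univ
  | d + 1 => W.offspringEvent j (survEvent j d)

theorem mem_survEvent_iff (k d : ℕ) (x : I) (ω : Noise) :
    (x, ω) ∈ W.survEvent (k - 1) d ↔ PropertyB k (W.rootedNum x ω) d [] := by
  induction d generalizing x ω with
  | zero => simp [survEvent, PropertyB]
  | succ d ih =>
    refine exists_congr fun S => and_congr_right fun _ => forall₂_congr fun i _ => ?_
    refine and_congr Iff.rfl ?_
    have h := propertyB_append k (W.rootedNum x ω) d i []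
    simp only [rootedNum_append] at h
    exact (ih _ _).trans h.symm

theorem propertyA_succ_iff (k d : ℕ) (ω : Noise) :
    PropertyA k (W.numChildren ω) (d + 1) ↔
      ((ω []).1, ω) ∈ W.offspringEvent k (W.survEvent (k - 1) d) := by
  rw [numChildren_eq]
  refine exists_congr fun S => and_congr_right fun _ => forall₂_congr fun i _ => ?_
  refine and_congr Iff.rfl ?_
  have h := propertyB_append k (W.rootedNum (ω []).1 ω) d i []
  simp only [rootedNum_append] at h
  exact h.trans (W.mem_survEvent_iff k d _ _).symm

theorem measurable_meanOffspring : Measurable W.meanOffspring :=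
  (W.measurable_intensity _).ennreal_toNNReal

theorem measurableSet_exists_offspring {α : Type*} [MeasurableSpace α] {r : α → ℝ≥0} {u x : α → I}
    {ζ : α → ℕ → Noise} (hr : Measurable r) (hu : Measurable u) (hx : Measurable x)
    (hζ : ∀ i, Measurable fun q => ζ q i) (j : ℕ) {D : Set (I × Noise)} (hD : MeasurableSet D) :
    MeasurableSet {q | ∃ S : Finset ℕ, S.card = j ∧ ∀ i ∈ S, i < poissonQuantile (r q) (u q) ∧
      (W.childType (x q) (ζ q i []).1, ζ q i) ∈ D} := by
  have : {q | ∃ S : Finset ℕ, S.card = j ∧ ∀ i ∈ S, i < poissonQuantile (r q) (u q) ∧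
      (W.childType (x q) (ζ q i []).1, ζ q i) ∈ D} =
      ⋃ (S : Finset ℕ) (_ : S.card = j), ⋂ i ∈ S, ({q | i < poissonQuantile (r q) (u q)} ∩
        {q | (W.childType (x q) (ζ q i []).1, ζ q i) ∈ D}) := by
    ext q; simp
  rw [this]
  refine MeasurableSet.iUnion fun S => MeasurableSet.iUnion fun _ =>
    S.measurableSet_biInter fun i _ => MeasurableSet.inter ?_ ?_
  · exact measurableSet_lt measurable_const (measurable_poissonQuantile.comp (hr.prodMk hu))
  · have h1 : Measurable fun q => (ζ q i []).1 :=
      measurable_fst.comp ((measurable_pi_apply []).comp (hζ i))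
    exact ((W.measurable_childType.comp (hx.prodMk h1)).prodMk (hζ i)) hD

theorem measurableSet_offspringEvent (j : ℕ) {D : Set (I × Noise)} (hD : MeasurableSet D) :
    MeasurableSet (W.offspringEvent j D) := by
  have hr : Measurable fun q : I × Noise => W.meanOffspring q.1 :=
    W.measurable_meanOffspring.comp measurable_fst
  have hu : Measurable fun q : I × Noise => (q.2 []).2 :=
    measurable_snd.comp ((measurable_pi_apply []).comp measurable_snd)
  have hζ : ∀ i, Measurable fun q : I × Noise => q.2.child i := fun i =>
    (measurable_noise_child i).comp measurable_snd
  exact W.measurableSet_exists_offspring hr hu measurable_fst hζ j hD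

theorem measurableSet_survEvent (j d : ℕ) : MeasurableSet (W.survEvent j d) := by
  cases d with
  | zero => exact MeasurableSet.univ
  | succ d =>
    induction d with
    | zero => exact W.measurableSet_offspringEvent j MeasurableSet.univ
    | succ d ih => exact W.measurableSet_offspringEvent j ih

theorem measurable_eval_root {g : I → I} (hg : Measurable g) :
    Measurable fun ω : Noise => (g (ω []).1, ω) :=
  (hg.comp (measurable_fst.comp (measurable_pi_apply []))).prodMk measurable_id

/-- If the type of the root is `g u` with `u` uniform, the number of children with the property `D`
is conditionally Poisson. -/
theorem measure_offspringEvent (j : ℕ) {D : Set (I × Noise)} (hD : MeasurableSet D) {g : I → I}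
    (hg : Measurable g) :
    noiseMeasure {ω | (g (ω []).1, ω) ∈ W.offspringEvent j D} =
      ∫⁻ u, ENNReal.ofReal (poissonTail j (W.meanOffspring (g u) *
        noiseMeasure.real {ω | (W.childType (g u) (ω []).1, ω) ∈ D})) := by
  set E : I → Set Noise := fun x => {ω | (W.childType x (ω []).1, ω) ∈ D} with hE_def
  have hE : ∀ x, MeasurableSet (E x) := fun x =>
    measurable_eval_root (W.measurable_childType.comp measurable_prodMk_left) hD
  set A : Set ((I × I) × (ℕ → Noise)) := {q | ∃ S : Finset ℕ, S.card = j ∧ ∀ i ∈ S,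
    i < poissonQuantile (W.meanOffspring (g q.1.1)) q.1.2 ∧
      (W.childType (g q.1.1) (q.2 i []).1, q.2 i) ∈ D} with hA_def
  have hr : Measurable fun q : (I × I) × (ℕ → Noise) => W.meanOffspring (g q.1.1) :=
    W.measurable_meanOffspring.comp (hg.comp (measurable_fst.comp measurable_fst))
  have hu : Measurable fun q : (I × I) × (ℕ → Noise) => q.1.2 := measurable_snd.comp measurable_fst
  have hx : Measurable fun q : (I × I) × (ℕ → Noise) => g q.1.1 :=
    hg.comp (measurable_fst.comp measurable_fst)
  have hζ : ∀ i, Measurable fun q : (I × I) × (ℕ → Noise) => q.2 i := fun i =>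
    (measurable_pi_apply i).comp measurable_snd
  have hA : MeasurableSet A := W.measurableSet_exists_offspring hr hu hx hζ j hD
  have hψ : Measurable fun ω : Noise => (ω [], fun i => ω.child i) :=
    (measurable_pi_apply []).prodMk (measurable_pi_lambda _ measurable_noise_child)
  -- The event depends only on the root pair and the sequence of subtrees, which are independent.
  have h1 : noiseMeasure {ω | (g (ω []).1, ω) ∈ W.offspringEvent j D} =
      ((volume : Measure (I × I)).prod (Measure.infinitePi fun _ : ℕ => noiseMeasure)) A := by
    rw [← map_noise_root_children, Measure.map_apply hψ hA]
    rfl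
  rw [h1, Measure.prod_apply hA, Measure.volume_eq_prod, lintegral_prod _
    (measurable_measure_prodMk_left hA).aemeasurable]
  refine lintegral_congr fun u => ?_
  set F : ℕ → ℝ := fun n =>
    1 - ∑ l ∈ Finset.range j, binomialProb (noiseMeasure.real (E (g u))) l n with hF
  have hFm : ∀ n, (Measure.infinitePi fun _ : ℕ => noiseMeasure).real
      {η | ∃ S : Finset ℕ, S.card = j ∧ ∀ i ∈ S, i < n ∧ η i ∈ E (g u)} = F n := fun n =>
    measureReal_exists_card noiseMeasure (hE (g u)) n j
  have h2 : ∀ s : I, (Measure.infinitePi fun _ : ℕ => noiseMeasure) (Prod.mk (u, s) ⁻¹' A) =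
      ENNReal.ofReal (F (poissonQuantile (W.meanOffspring (g u)) s)) := fun s => by
    rw [← hFm, ofReal_measureReal]
    rfl
  simp only [h2]
  -- With the root type fixed, `F n` is the probability given `n` children; averaging over the
  -- Poisson law of `n` is thinning.
  rw [← lintegral_map (f := fun n => ENNReal.ofReal (F n)) .of_discrete
    (Measurable.of_uncurry_left (f := poissonQuantile) measurable_poissonQuantile),
    map_poissonQuantile, ← integral_poissonMeasure_one_sub_binomialProb _ measureReal_nonneg
    measureReal_le_one, ofReal_integral_eq_lintegral_ofReal]
  · refine Integrable.of_bound (Measurable.of_discrete).aestronglyMeasurable 1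
      (Eventually.of_forall fun n => ?_)
    change ‖F n‖ ≤ 1
    rw [← hFm, Real.norm_of_nonneg measureReal_nonneg]
    exact measureReal_le_one
  · refine Eventually.of_forall fun n => ?_
    change 0 ≤ F n
    rw [← hFm]
    exact measureReal_nonneg

/-- The probability that a particle of type `x` has property `𝓑_d`. -/
noncomputable def typeProb (j : ℕ) : ℕ → I → ℝ
  | 0 => fun _ => 1
  | d + 1 => fun x => poissonTail j (W.meanOffspring x * ∫ u, typeProb j d (W.childType x u))

theorem isUnitFun_typeProb (j d : ℕ) : IsUnitFun (W.typeProb j d) := by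
  induction d with
  | zero => exact ⟨measurable_const, fun _ => zero_le_one, fun _ => le_rfl⟩
  | succ d ih =>
    have h : ∀ x, 0 ≤ (W.meanOffspring x : ℝ) * ∫ u, W.typeProb j d (W.childType x u) := fun x =>
      mul_nonneg NNReal.zero_le_coe (integral_nonneg fun u => ih.nonneg _)
    refine ⟨(measurable_poissonTail j).comp ?_, fun x => poissonTail_nonneg j (h x),
      fun x => poissonTail_le_one j (h x)⟩
    have h1 : StronglyMeasurable fun p : I × I => W.typeProb j d (W.childType p.1 p.2) :=
      (ih.measurable.comp W.measurable_childType).stronglyMeasurable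
    exact W.measurable_meanOffspring.coe_nnreal_real.mul h1.integral_prod_right.measurable

/-- A general `g` is needed for the induction: a child's type is `W.childType x` of its own uniform
variable. -/
theorem measureReal_survEvent (j d : ℕ) {g : I → I} (hg : Measurable g) :
    noiseMeasure.real {ω | (g (ω []).1, ω) ∈ W.survEvent j d} = ∫ u, W.typeProb j d (g u) := by
  induction d generalizing g with
  | zero => simp [survEvent, typeProb]
  | succ d ih =>
    have h1 := W.measure_offspringEvent j (W.measurableSet_survEvent j d) hg
    have h2 : ∀ x, noiseMeasure.real {ω | (W.childType x (ω []).1, ω) ∈ W.survEvent j d} =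
        ∫ u, W.typeProb j d (W.childType x u) := fun x =>
      ih (W.measurable_childType.comp measurable_prodMk_left)
    simp only [h2] at h1
    have hu := W.isUnitFun_typeProb j (d + 1)
    rw [measureReal_def, survEvent, h1, integral_eq_lintegral_of_nonneg_ae
      (Eventually.of_forall fun u => hu.nonneg _) (hu.measurable.comp hg).aestronglyMeasurable]
    rfl

theorem measureReal_propertyA_succ (k d : ℕ) :
    noiseMeasure.real {ω | PropertyA k (W.numChildren ω) (d + 1)} =
      ∫ x, poissonTail k (W.meanOffspring x * ∫ u, W.typeProb (k - 1) d (W.childType x u)) := by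
  have h1 := W.measure_offspringEvent k (W.measurableSet_survEvent (k - 1) d) measurable_id
  have h2 : ∀ x, noiseMeasure.real {ω | (W.childType x (ω []).1, ω) ∈ W.survEvent (k - 1) d} =
      ∫ u, W.typeProb (k - 1) d (W.childType x u) := fun x =>
    W.measureReal_survEvent _ d (W.measurable_childType.comp measurable_prodMk_left)
  simp only [h2, id] at h1
  have hu := W.isUnitFun_typeProb (k - 1) d
  have h3 : ∀ x, 0 ≤ (W.meanOffspring x : ℝ) * ∫ u, W.typeProb (k - 1) d (W.childType x u) :=
    fun x => mul_nonneg NNReal.zero_le_coe (integral_nonneg fun u => hu.nonneg _)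
  have h4 : StronglyMeasurable fun p : I × I => W.typeProb (k - 1) d (W.childType p.1 p.2) :=
    (hu.measurable.comp W.measurable_childType).stronglyMeasurable
  rw [integral_eq_lintegral_of_nonneg_ae
    (Eventually.of_forall fun x => poissonTail_nonneg k (h3 x))
    ((measurable_poissonTail k).comp (W.measurable_meanOffspring.coe_nnreal_real.mul
      h4.integral_prod_right.measurable)).aestronglyMeasurable, ← h1, measureReal_def]
  simp only [propertyA_succ_iff]

theorem tendsto_measureReal_propertyA (k : ℕ) :
    Tendsto (fun d => noiseMeasure.real {ω | PropertyA k (W.numChildren ω) (d + 1)}) atTop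
      (𝓝 (probA k W)) := by
  refine (tendsto_add_atTop_iff_nat (f := fun d =>
    noiseMeasure.real {ω | PropertyA k (W.numChildren ω) d}) 1).2 ?_
  refine (ENNReal.tendsto_toReal (measure_ne_top _ _)).comp (tendsto_measure_iInter_atTop
    (fun d => MeasurableSet.nullMeasurableSet ?_) ?_ ⟨0, measure_ne_top _ _⟩)
  · cases d with
    | zero => exact MeasurableSet.univ
    | succ d =>
      simp only [propertyA_succ_iff]
      exact measurable_eval_root measurable_id
        (W.measurableSet_offspringEvent k (W.measurableSet_survEvent (k - 1) d))
  · exact antitone_nat_of_succ_le fun d ω h => propertyA_of_succ d h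

/-! ### The probability as a function of a bounded kernel -/

variable {W}

/-- By Fubini almost every section of `W` agrees with that of `V` almost everywhere, so the
intensity is finite there. Allowing `f'` to differ from `f` on a null set lets the identity pass
through the recursion in `d`. -/
theorem ae_meanOffspring_mul_integral_eq {a : ℝ} {V : I × I → ℝ} (hV : IsBddKernel a V)
    (hWV : ∀ᵐ p : I × I, (W p : ℝ) = V p) : ∀ᵐ x : I, ∀ f f' : I → ℝ, Measurable f → f =ᵐ[volume] f' →
      W.meanOffspring x * ∫ u, f (W.childType x u) = kernelOp V f' x := by
  have h : ∀ᵐ x : I, ∀ᵐ y : I, (W (x, y) : ℝ) = V (x, y) := Measure.ae_ae_of_ae_prod hWV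
  filter_upwards [h] with x hx f f' hf hff'
  have hfin : W.intensity x Set.univ ≠ ∞ := by
    have hle : W.intensity x Set.univ ≤ ENNReal.ofReal a := by
      calc W.intensity x Set.univ ≤ ∫⁻ _ : I, ENNReal.ofReal a := by
            rw [intensity, Measure.restrict_univ]
            refine lintegral_mono_ae ?_
            filter_upwards [hx] with y hy
            rw [← ENNReal.ofReal_coe_nnreal, hy]
            exact ENNReal.ofReal_le_ofReal (hV.le _)
        _ = ENNReal.ofReal a := by simp
    exact ne_top_of_le_ne_top ENNReal.ofReal_ne_top hle
  refine (W.toReal_intensity_mul_integral_childType hfin hf).trans (integral_congr_ae ?_)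
  filter_upwards [hx, hff'] with y hy hfy
  rw [hy, hfy]

theorem typeProb_ae_eq_survProb {a : ℝ} {V : I × I → ℝ} (hV : IsBddKernel a V)
    (hWV : ∀ᵐ p : I × I, (W p : ℝ) = V p) (j d : ℕ) :
    W.typeProb j d =ᵐ[volume] survProb j V d := by
  induction d with
  | zero => exact ae_eq_rfl
  | succ d ih =>
    filter_upwards [ae_meanOffspring_mul_integral_eq hV hWV] with x hx
    simp only [typeProb, survProb]
    rw [hx _ _ (W.isUnitFun_typeProb j d).measurable ih]

theorem probA_eq_rootProb {a : ℝ} {V : I × I → ℝ} (hV : IsBddKernel a V)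
    (hWV : ∀ᵐ p : I × I, (W p : ℝ) = V p) (j : ℕ) : probA (j + 1) W = rootProb j V := by
  refine tendsto_nhds_unique (W.tendsto_measureReal_propertyA (j + 1))
    ((hV.tendsto_integral_survProb j).congr fun d => ?_)
  rw [measureReal_propertyA_succ, Nat.add_sub_cancel]
  refine integral_congr_ae ?_
  filter_upwards [ae_meanOffspring_mul_integral_eq hV hWV] with x hx
  rw [hx _ _ (W.isUnitFun_typeProb j d).measurable (typeProb_ae_eq_survProb hV hWV j d)]

end Graphon

/-! ### Convergence in the cut metric -/

theorem Graphon.measurable_coe_real (W : Graphon) : Measurable fun p => (W p : ℝ) :=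
  W.measurable'.coe_nnreal_real

theorem integrable_of_cutNorm_ne_top {U : I × I → ℝ} (h : cutNorm U ≠ ∞) : Integrable U := by
  by_contra hU
  exact h (if_neg hU)

theorem enorm_setIntegral_le_cutNorm (U : I × I → ℝ) {S T : Set I} (hS : MeasurableSet S)
    (hT : MeasurableSet T) : ‖∫ p in S ×ˢ T, U p‖ₑ ≤ cutNorm U := by
  unfold cutNorm
  split_ifs
  · exact le_iSup_of_le S (le_iSup_of_le T (le_iSup_of_le hS (le_iSup_of_le hT le_rfl)))
  · exact le_top

theorem cutNorm_ne_top {U : I × I → ℝ} (hU : Integrable U) : cutNorm U ≠ ∞ := by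
  refine ne_top_of_le_ne_top hU.2.ne ?_
  rw [cutNorm, if_pos hU]
  refine iSup_le fun S => iSup_le fun T => iSup_le fun _ => iSup_le fun _ => ?_
  exact (enorm_integral_le_lintegral_enorm _).trans (setLIntegral_le_lintegral _ _)

theorem abs_setIntegral_le_cutNorm {U : I × I → ℝ} (hU : Integrable U) {S T : Set I}
    (hS : MeasurableSet S) (hT : MeasurableSet T) :
    |∫ p in S ×ˢ T, U p| ≤ (cutNorm U).toReal := by
  have := ENNReal.toReal_mono (cutNorm_ne_top hU) (enorm_setIntegral_le_cutNorm U hS hT)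
  rwa [toReal_enorm, Real.norm_eq_abs] at this

/-- For bounded kernels, convergence of the integrals over rectangles implies convergence of the
integrals over all measurable sets. -/
theorem tendsto_setIntegral_of_rectangles {a : ℝ} {Vn : ℕ → I × I → ℝ} {V : I × I → ℝ}
    (hVn : ∀ n, IsBddKernel a (Vn n)) (hV : Integrable V)
    (h : ∀ S T : Set I, MeasurableSet S → MeasurableSet T →
      Tendsto (fun n => ∫ p in S ×ˢ T, Vn n p) atTop (𝓝 (∫ p in S ×ˢ T, V p)))
    {A : Set (I × I)} (hA : MeasurableSet A) :
    Tendsto (fun n => ∫ p in A, Vn n p) atTop (𝓝 (∫ p in A, V p)) := by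
  have hVni : ∀ n, Integrable (Vn n) := fun n =>
    integrable_of_abs_le (hVn n).measurable (hVn n).abs_le
  have ha := (hVn 0).bound_nonneg
  induction A, hA using MeasurableSpace.induction_on_inter generateFrom_prod.symm isPiSystem_prod
    with
  | empty => simp
  | basic A hA =>
    obtain ⟨S, hS, T, hT, rfl⟩ := hA
    exact h S T hS hT
  | compl A hA ih =>
    have huniv := h Set.univ Set.univ MeasurableSet.univ MeasurableSet.univ
    simp only [Set.univ_prod_univ, setIntegral_univ] at huniv
    have e : ∀ U : I × I → ℝ, Integrable U → ∫ p in Aᶜ, U p = (∫ p, U p) - ∫ p in A, U p :=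
      fun U hU => by rw [← integral_add_compl hA hU]; ring
    rw [e V hV]
    exact (huniv.sub ih).congr fun n => (e _ (hVni n)).symm
  | iUnion A hd hA ih =>
    have e : ∀ U : I × I → ℝ, Integrable U → ∫ p in ⋃ i, A i, U p = ∑' i, ∫ p in A i, U p :=
      fun U hU => integral_iUnion hA hd hU.integrableOn
    rw [e V hV]
    simp only [e _ (hVni _)]
    -- The uniform bound `a` dominates the series by `a |A i|`, so the limit passes through the
    -- countable union.
    refine tendsto_tsum_of_dominated_convergence (bound := fun i => a * volume.real (A i)) ?_ ih
      (Eventually.of_forall fun n i => ?_)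
    · refine Summable.mul_left a (ENNReal.summable_toReal ?_)
      rw [← measure_iUnion hd hA]
      exact measure_ne_top _ _
    · exact norm_setIntegral_le_of_norm_le_const (measure_lt_top _ _)
        fun p _ => (hVn n).abs_le p

/-- The bound on integrals survives the limit on every measurable set, which forces it almost
everywhere. -/
theorem ae_le_of_tendsto_rectangles {a : ℝ} {Vn : ℕ → I × I → ℝ} {V : I × I → ℝ}
    (hVn : ∀ n, IsBddKernel a (Vn n)) (hV : Integrable V)
    (h : ∀ S T : Set I, MeasurableSet S → MeasurableSet T →
      Tendsto (fun n => ∫ p in S ×ˢ T, Vn n p) atTop (𝓝 (∫ p in S ×ˢ T, V p))) :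
    ∀ᵐ p, V p ≤ a := by
  refine ae_le_of_forall_setIntegral_le hV (integrable_const a) fun A hA _ => ?_
  refine le_of_tendsto' (tendsto_setIntegral_of_rectangles hVn hV h hA) fun n => ?_
  exact setIntegral_mono (integrable_of_abs_le (hVn n).measurable (hVn n).abs_le).integrableOn
    (integrable_const a).integrableOn (hVn n).le

theorem mainTheorem2 (k : ℕ) (hk : 2 ≤ k) (Wseq : ℕ → Graphon) (W : Graphon)
    (a : ℝ≥0) (hbound : ∀ (n : ℕ) (x y : I), Wseq n (x, y) ≤ a)
    (hconv : Tendsto (fun n => cutDist (Wseq n) W) atTop (𝓝 0))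
    (hcont : ContinuousWithinAt (fun c : ℝ≥0 => Graphon.probA k (c • W)) (Set.Iic 1) 1) :
    Tendsto (fun n => Graphon.probA k (Wseq n)) atTop (𝓝 (Graphon.probA k W)) := by
  obtain ⟨j, rfl⟩ := Nat.exists_eq_add_of_le' (show 1 ≤ k by omega)
  have hj : 1 ≤ j := by omega
  have hVn : ∀ n, IsBddKernel a fun p => (Wseq n p : ℝ) := fun n =>
    ⟨(Wseq n).measurable_coe_real, fun p => NNReal.coe_nonneg _,
      fun p => NNReal.coe_le_coe.2 (hbound n p.1 p.2)⟩
  have hVni : ∀ n, Integrable fun p => (Wseq n p : ℝ) := fun n =>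
    integrable_of_abs_le (hVn n).measurable (hVn n).abs_le
  -- `W` is not assumed integrable; a finite cut distance to one bounded `Wseq n` forces it.
  have hWi : Integrable fun p => (W p : ℝ) := by
    obtain ⟨n, hn⟩ := (hconv.eventually_lt_const ENNReal.zero_lt_top).exists
    have := (hVni n).sub (integrable_of_cutNorm_ne_top hn.ne)
    simpa [Pi.sub_def] using this
  set δ : ℕ → ℝ := fun n => (cutDist (Wseq n) W).toReal with hδ_def
  have hδ : Tendsto δ atTop (𝓝 0) := by
    simpa [Function.comp_def] using (ENNReal.tendsto_toReal ENNReal.zero_ne_top).comp hconv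
  have hrect : ∀ n, CutLe (δ n) (fun p => (Wseq n p : ℝ)) fun p => (W p : ℝ) := fun n S T hS hT =>
    abs_setIntegral_le_cutNorm ((hVni n).sub hWi) hS hT
  have hWa : ∀ᵐ p : I × I, (W p : ℝ) ≤ a := by
    refine ae_le_of_tendsto_rectangles hVn hWi fun S T hS hT => ?_
    rw [tendsto_iff_norm_sub_tendsto_zero]
    refine squeeze_zero (fun n => norm_nonneg _) (fun n => ?_) hδ
    rw [← integral_sub (hVni n).integrableOn hWi.integrableOn]
    exact hrect n S T hS hT
  set V : I × I → ℝ := fun p => min (W p : ℝ) a with hV_def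
  have hWV : ∀ᵐ p : I × I, (W p : ℝ) = V p := by
    filter_upwards [hWa] with p hp
    exact (min_eq_left hp).symm
  have hV : IsBddKernel a V := ⟨W.measurable_coe_real.min measurable_const,
    fun p => le_min (NNReal.coe_nonneg _) (NNReal.coe_nonneg _), fun p => min_le_right _ _⟩
  have hcut : ∀ n, CutLe (δ n) (fun p => (Wseq n p : ℝ)) V := fun n S T hS hT => by
    refine le_trans (le_of_eq ?_) (hrect n S T hS hT)
    congr 1
    refine integral_congr_ae (ae_restrict_of_ae ?_)
    filter_upwards [hWV] with p hp
    rw [hp]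
  have hPn : ∀ n, Graphon.probA (j + 1) (Wseq n) = rootProb j fun p => (Wseq n p : ℝ) := fun n =>
    Graphon.probA_eq_rootProb (hVn n) (Eventually.of_forall fun _ => rfl) j
  have hP : Graphon.probA (j + 1) W = rootProb j V := Graphon.probA_eq_rootProb hV hWV j
  have hPc : ∀ c : ℝ≥0, c ≤ 1 →
      Graphon.probA (j + 1) (c • W) = rootProb j fun p => (c : ℝ) * V p := fun c hc => by
    refine Graphon.probA_eq_rootProb (hV.smul c.coe_nonneg (NNReal.coe_le_coe.2 hc)) ?_ j
    filter_upwards [hWV] with p hp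
    rw [← hp]
    exact NNReal.coe_mul c (W p)
  have hP1 : Graphon.probA (j + 1) ((1 : ℝ≥0) • W) = rootProb j V := by
    rw [hPc 1 le_rfl]
    simp
  rw [hP]
  simp only [hPn]
  refine tendsto_order.2 ⟨fun b hb => ?_, fun b hb => ?_⟩
  · have hlim : Tendsto (fun c : ℝ≥0 => Graphon.probA (j + 1) (c • W)) (𝓝[<] 1)
        (𝓝 (rootProb j V)) := by
      rw [← hP1]
      exact hcont.mono_left (nhdsWithin_mono _ Set.Iio_subset_Iic_self)
    have hne : NeBot (𝓝[<] (1 : ℝ≥0)) := nhdsLT_neBot_of_exists_lt ⟨0, zero_lt_one⟩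
    have hpos : ∀ᶠ c : ℝ≥0 in 𝓝[<] 1, 0 < c :=
      eventually_nhdsWithin_of_eventually_nhds (lt_mem_nhds zero_lt_one)
    obtain ⟨c, ⟨hcb, hc0⟩, hc1⟩ := ((hlim.eventually_const_lt hb).and hpos).and
      self_mem_nhdsWithin |>.exists
    have hc1 : c < 1 := hc1
    rw [hPc c hc1.le] at hcb
    -- The lower bound spends the factor `c` in two equal parts, so `s = √c`.
    have hs : Real.sqrt c ^ 2 = (c : ℝ) := Real.sq_sqrt c.coe_nonneg
    have hs0 : 0 < Real.sqrt c := Real.sqrt_pos.2 (NNReal.coe_pos.2 hc0)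
    have hs1 : Real.sqrt c < 1 := by
      rw [Real.sqrt_lt' zero_lt_one, one_pow]
      exact NNReal.coe_lt_coe.2 hc1
    have h := eventually_le_rootProb hVn hV hcut hδ hj hs0 hs1 (half_pos (sub_pos.2 hcb))
    rw [hs] at h
    filter_upwards [h] with n hn
    linarith
  · filter_upwards [eventually_rootProb_le hVn hV hcut hδ j (half_pos (sub_pos.2 hb))] with n hn
    linarith
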